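/- **Setting.** Let $0<q<1$, $a>0$, $0<\alpha<1$, $A_{q,a}=\{aq^n:n\ge 0\}$, $A^*_{q,a}=A_{q,a}\cup\{0\}$. Write $(z;q)_\infty=\prod_{k\ge0}(1-zq^k)$, $(z;q)_\nu=(z;q)_\infty/(zq^\nu;q)_\infty$, $\Gamma_q(x)=\frac{(q;q)_\infty}{(q^x;q)_\infty}(1-q)^{1-x}$, $\int_0^b f\,d_qt=(1-q)b\sum_{n\ge0}q^nf(bq^n)$, $\int_b^c=\int_0^c-\int_0^b$, $D_qf(x)=\frac{f(x)-f(qx)}{x-qx}$ and $$I^{\nu}_{q,0^+}f(x)=\frac{x^{\nu-1}}{\Gamma_q(\nu)}\int_0^x(qt/x;q)_{\nu-1}f(t)\,d_qt,\qquad I^{\nu}_{q,a^-}f(x)=\frac1{\Gamma_q(\nu)}\int_{qx}^a t^{\nu-1}(qx/t;q)_{\nu-1}f(t)\,d_qt,$$ ${}^cD^\alpha_{q,0^+}f=I^{1-\alpha}_{q,0^+}D_qf$ and $D^\alpha_{q,a^-}f=-\frac1qD_{q^{-1}}I^{1-\alpha}_{q,a^-}f$, where $D_{q^{-1}}g(0)$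 means $\lim_n\frac{g(aq^n)-g(0)}{aq^n}$. A function $f$ on $A^*_{q,a}$ is *$q$-regular at zero* if $f(xq^n)\to f(0)$ for all $x\in A^*_{q,a}$; $L^2_q(A^*_{q,a})$ is the space of $f$ with $\|f\|_2=(\int_0^a|f|^2d_qt)^{1/2}<\infty$. Let $p,r,w_\alpha$ be real functions on $A^*_{q,a}$ with $p\ne0$ and $w_\alpha>0$ on $A^*_{q,a}$, $\inf_{A_{q,a}}p>0$ and $r,w_\alpha\in L^2_q(A^*_{q,a})$; let $c_1,c_2,d_1,d_2\in\mathbb R$ with $c_1^2+c_2^2\neq0$, $d_1^2+d_2^2\ne0$. For $\lambda\in\mathbb K$ ($\mathbb K=\mathbb R$ or $\mathbb C$) consider, for $y:A^*_{q,a}\to\mathbb K$, the problem (P) $$D^\alpha_{q,a^-}\big(p\,{}^cD^\alpha_{q,0^+}y\big)(x)+r(x)y(x)-\lambda w_\alpha(x)y(x)=0,\quad x\in A^*_{q,a},$$ $$c_1y(0)+c_2u(0)=0,\qquad d_1y(a)+d_2u(a/q)=0,\qquad u:=I^{1-\alpha}_{q,a^-}\big(p\,{}^cD^\alpha_{q,0^+}y\big).$$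 Here $u(a/q)$ enters also in the equation at $x=a$, and it is $0$ when its defining $q$-integral (from $a$ to $a$) is taken literally. Call $y$ an *extended solution* if it is $q$-regular at zero, the equation, with its first term written as $-\frac1qD_{q^{-1}}u$, holds on $A_{q,a}$, and the boundary conditions hold, for some choice of the value $u(a/q)\in\mathbb K$. Every $q$-regular solution of (P) is an extended solution. $\lambda$ is an *eigenvalue* if it has an extended solution $y\not\equiv0$ on $A^*_{q,a}$, and it is *simple* if, moreover, all extended solutions are constant multiples of one of them. Put $\psi(x)=I^\alpha_{q,0^+}\Big[\frac{a^{\alpha-1}(q\,\cdot/a;q)_{\alpha-1}}{\Gamma_q(\alpha)p(\cdot)}\Big](x)$, $\Delta=c_1d_2-c_2d_1+c_1d_1\psi(a)$, and, when $\Delta\ne0$, $$A=\sup_{x\in A^*_{q,a}}\Big|\tfrac{c_2}{\Delta}\big[d_2+d_1(\psi(a)-\psi(x))\big]\Big|,\quad B=\sup_{x\in A^*_{q,a}}\Big|\tfrac{d_1}{\Delta}\big[c_1\psi(x)-c_2\big]\Big|,\quad m_p=\inf_{x\in A_{q,a}}|p(x)|.$$ **Theorem 3.8.** Assume $\Delta\neq0$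 and that $\lambda$ satisfies $$\|r-\lambda w_\alpha\|_2<\frac{m_p}{(1+B)a^{2\alpha-\frac12}c_\alpha+A\sqrt a\,m_p},\qquad c_\alpha=\frac{(1-q)^{\alpha-\frac12}}{(q;q)_\infty\sqrt{1-q^{2\alpha-1}}},\qquad\text{if }\tfrac12<\alpha<1,$$ or $$\|r-\lambda w_\alpha\|_2<\frac{m_p}{(1+B)a^{2\alpha-\frac12}\gamma_\alpha+A\sqrt a\,m_p},\qquad \gamma_\alpha=\frac{\Gamma_q(\alpha+\frac12)}{(q^\alpha;q)_\infty\Gamma_q(2\alpha+\frac12)}\sqrt{\frac{1-q}{1-q^{1-2\alpha}}},\qquad\text{if }\tfrac14<\alpha<\tfrac12.$$ Then there is exactly one $q$-regular at zero function $y_\lambda$ on $A^*_{q,a}$ that solves (P) (with $u(a/q)$ taken literally), and $y_\lambda$ is also the only extended solution. If $\lambda$ is moreover an eigenvalue, then it is simple. -/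

import Mathlib

open Filter Topology Set

noncomputable section

namespace QFSL

/-- `A_{q,a} = {a qⁿ : n ∈ ℕ₀}`. -/
def grid (q a : ℝ) : Set ℝ := {x | ∃ n : ℕ, x = a * q ^ n}

/-- `A*_{q,a} = A_{q,a} ∪ {0}`. -/
def gridZero (q a : ℝ) : Set ℝ := insert 0 (grid q a)

/-- The infinite `q`-shifted factorial `(z; q)_∞ = ∏_{k ≥ 0} (1 - z q^k)`. -/
def qPochInf (q z : ℝ) : ℝ := ∏' k : ℕ, (1 - z * q ^ k)

/-- `(z; q)_ν = (z; q)_∞ / (z q^ν; q)_∞` for a real exponent `ν`. -/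
def qPoch (q z ν : ℝ) : ℝ := qPochInf q z / qPochInf q (z * q ^ ν)

/-- `Γ_q(x) = (q; q)_∞ / (q^x; q)_∞ * (1 - q)^(1 - x)`. -/
def qGamma (q x : ℝ) : ℝ :=
  qPochInf q q / qPochInf q (q ^ x) * (1 - q) ^ (1 - x)

section Operators

variable {E : Type*} [NormedAddCommGroup E] [NormedSpace ℝ E]

/-- Jackson's integral `∫_0^b f d_q t = (1 - q) b ∑_{n ≥ 0} qⁿ f(b qⁿ)`, the series being summed
in the ordinary sense (limit of its partial sums, not necessarily absolutely convergent). -/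
def qIntZero (q b : ℝ) (f : ℝ → E) : E :=
  ((1 - q) * b) • ∑'[SummationFilter.conditional ℕ] n : ℕ, (q ^ n) • f (b * q ^ n)

/-- `∫_b^c f d_q t = ∫_0^c f d_q t - ∫_0^b f d_q t`. -/
def qInt (q b c : ℝ) (f : ℝ → E) : E := qIntZero q c f - qIntZero q b f

/-- Jackson's `q`-difference operator `D_q f(x) = (f(x) - f(qx)) / (x - qx)` at points `x ≠ 0`
(the base may also be `q⁻¹`). -/
def qDeriv (q : ℝ) (f : ℝ → E) (x : ℝ) : E := (x - q * x)⁻¹ • (f x - f (q * x))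

/-- The left-sided Riemann–Liouville operator
`I^ν_{q,0+} f(x) = x^(ν-1) / Γ_q(ν) * ∫_0^x (qt/x; q)_{ν-1} f(t) d_q t`. -/
def leftInt (q ν : ℝ) (f : ℝ → E) (x : ℝ) : E :=
  (x ^ (ν - 1) / qGamma q ν) • qInt q 0 x (fun t => qPoch q (q * t / x) (ν - 1) • f t)

/-- The right-sided Riemann–Liouville operator
`I^ν_{q,a-} f(x) = 1 / Γ_q(ν) * ∫_{qx}^a t^(ν-1) (qx/t; q)_{ν-1} f(t) d_q t`. -/
def rightInt (q a ν : ℝ) (f : ℝ → E) (x : ℝ) : E :=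
  (1 / qGamma q ν) •
    qInt q (q * x) a (fun t => (t ^ (ν - 1) * qPoch q (q * x / t) (ν - 1)) • f t)

/-- The left-sided Caputo derivative `I^{1-α}_{q,0+} D_q f` of order `α ∈ (0, 1)`. -/
def leftCaputo (q α : ℝ) (f : ℝ → E) : ℝ → E := leftInt q (1 - α) (qDeriv q f)

/-- The right-sided Riemann–Liouville derivative `(-1/q) D_{q⁻¹} I^{1-α}_{q,a-} f` of order
`α ∈ (0, 1)`, at points `x ≠ 0`. -/
def rightDeriv (q a α : ℝ) (f : ℝ → E) (x : ℝ) : E :=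
  (-1 / q) • qDeriv q⁻¹ (rightInt q a (1 - α) f) x

/-- The quasi-derivative `I^{1-α}_{q,a-} (p · ᶜD^α_{q,0+} y)`. -/
def quasiDeriv (q a α : ℝ) (p : ℝ → ℝ) (y : ℝ → E) : ℝ → E :=
  rightInt q a (1 - α) (fun t => p t • leftCaputo q α y t)

/-- `f` is `q`-regular at zero on `A*_{q,a}`, i.e. belongs to `C(A*_{q,a})`. -/
def IsQRegular (q a : ℝ) (f : ℝ → E) : Prop :=
  ∀ x ∈ gridZero q a, Tendsto (fun n : ℕ => f (x * q ^ n)) atTop (𝓝 (f 0))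

/-- `f ∈ L²_q(A*_{q,a})`, i.e. `∫_0^a |f|² d_q x < ∞`. -/
def MemL2 (q a : ℝ) (f : ℝ → E) : Prop :=
  Summable fun n : ℕ => q ^ n * ‖f (a * q ^ n)‖ ^ 2

/-- `‖f‖_2 = (∫_0^a |f|² d_q x)^(1/2)`. -/
def normL2 (q a : ℝ) (f : ℝ → E) : ℝ := Real.sqrt (qInt q 0 a (fun t => ‖f t‖ ^ 2))

/-- The sup norm over `A*_{q,a}`. -/
def supNorm (q a : ℝ) (f : ℝ → E) : ℝ := ⨆ x : gridZero q a, ‖f x‖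

end Operators

/-- `ψ_{α,a}(x) = I^α_{q,0+} [a^(α-1) (q·/a; q)_{α-1} / (Γ_q(α) p(·))] (x)`. -/
def psi (q a α : ℝ) (p : ℝ → ℝ) : ℝ → ℝ :=
  leftInt q α (fun x => a ^ (α - 1) * qPoch q (q * x / a) (α - 1) / (qGamma q α * p x))

/-- `Δ = c₁ d₂ - c₂ d₁ + c₁ d₁ ψ_{α,a}(a)`. -/
def Delta (q a α : ℝ) (p : ℝ → ℝ) (c₁ c₂ d₁ d₂ : ℝ) : ℝ :=
  c₁ * d₂ - c₂ * d₁ + c₁ * d₁ * psi q a α p a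

/-- `A(x) = (c₂ / Δ) [d₂ + d₁ (ψ(a) - ψ(x))]`. -/
def coefA (q a α : ℝ) (p : ℝ → ℝ) (c₁ c₂ d₁ d₂ : ℝ) (x : ℝ) : ℝ :=
  c₂ / Delta q a α p c₁ c₂ d₁ d₂ * (d₂ + d₁ * (psi q a α p a - psi q a α p x))

/-- `B(x) = (d₁ / Δ) [c₁ ψ(x) - c₂]`. -/
def coefB (q a α : ℝ) (p : ℝ → ℝ) (c₁ c₂ d₁ d₂ : ℝ) (x : ℝ) : ℝ :=
  d₁ / Delta q a α p c₁ c₂ d₁ d₂ * (c₁ * psi q a α p x - c₂)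

/-- `m_p = inf_{x ∈ A_{q,a}} |p(x)|`. -/
def infAbs (q a : ℝ) (p : ℝ → ℝ) : ℝ := ⨅ x : grid q a, |p x|

/-- `c_α = (1 - q)^(α - 1/2) / ((q; q)_∞ √(1 - q^(2α - 1)))`. -/
def cConst (q α : ℝ) : ℝ :=
  (1 - q) ^ (α - 1 / 2) / (qPochInf q q * Real.sqrt (1 - q ^ (2 * α - 1)))

/-- `γ_α = Γ_q(α + 1/2) / ((q^α; q)_∞ Γ_q(2α + 1/2)) √((1 - q) / (1 - q^(1 - 2α)))`. -/
def gammaConst (q α : ℝ) : ℝ :=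
  qGamma q (α + 1 / 2) / (qPochInf q (q ^ α) * qGamma q (2 * α + 1 / 2)) *
    Real.sqrt ((1 - q) / (1 - q ^ (1 - 2 * α)))

/-- The bound `m_p / ((1 + B) a^(2α - 1/2) κ + A √a m_p)` with `A = ‖A(·)‖`, `B = ‖B(·)‖`. -/
def bound (q a α : ℝ) (p : ℝ → ℝ) (c₁ c₂ d₁ d₂ κ : ℝ) : ℝ :=
  infAbs q a p /
    ((1 + supNorm q a (coefB q a α p c₁ c₂ d₁ d₂)) * a ^ (2 * α - 1 / 2) * κ +
      supNorm q a (coefA q a α p c₁ c₂ d₁ d₂) * Real.sqrt a * infAbs q a p)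

section Problem

variable {𝕜 : Type*} [RCLike 𝕜]

/-- `y` is a `q`-regular at zero solution of
`D^α_{q,a-} (p · ᶜD^α_{q,0+} y) + r y - λ w y = 0` on `A*_{q,a}` with the two boundary conditions.
At `x = 0` the operator `D_{q⁻¹}` is the limit of the difference quotients along the grid. -/
structure IsSolution (q a α : ℝ) (p r w : ℝ → ℝ) (c₁ c₂ d₁ d₂ : ℝ) (lam : 𝕜)
    (y : ℝ → 𝕜) : Prop where
  regular : IsQRegular q a y
  equation : ∀ x ∈ grid q a,
    rightDeriv q a α (fun t => p t • leftCaputo q α y t) x + r x • y x - lam * (w x • y x) = 0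
  equation_zero : ∃ l : 𝕜,
    Tendsto (fun n : ℕ => (a * q ^ n)⁻¹ • (quasiDeriv q a α p y (a * q ^ n) -
      quasiDeriv q a α p y 0)) atTop (𝓝 l) ∧
    (-1 / q) • l + r 0 • y 0 - lam * (w 0 • y 0) = 0
  bc_zero : c₁ • y 0 + c₂ • quasiDeriv q a α p y 0 = 0
  bc_right : d₁ • y a + d₂ • quasiDeriv q a α p y (a / q) = 0

/-- A weaker notion of solution. Here `u` is the quasi-derivative of `y` on `A*_{q,a}`, while its
value at the outer point `a / q` is free. (The `q`-integral defining the quasi-derivative at `a / q`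
runs from `a` to `a`; reading it literally means the choice `u (a / q) = 0`.) The value `u (a / q)`
enters through the equation at `x = a` and through the second boundary condition. Nothing is
required of the equation at the point `x = 0`, which is negligible for the `q`-integral. -/
structure IsExtSolution (q a α : ℝ) (p r w : ℝ → ℝ) (c₁ c₂ d₁ d₂ : ℝ) (lam : 𝕜)
    (y u : ℝ → 𝕜) : Prop where
  regular : IsQRegular q a y
  quasi : ∀ x ∈ gridZero q a, u x = quasiDeriv q a α p y x
  equation : ∀ x ∈ grid q a,
    (-1 / q) • qDeriv q⁻¹ u x + r x • y x - lam * (w x • y x) = 0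
  bc_zero : c₁ • y 0 + c₂ • u 0 = 0
  bc_right : d₁ • y a + d₂ • u (a / q) = 0

theorem IsSolution.isExtSolution {q a α : ℝ} {p r w : ℝ → ℝ} {c₁ c₂ d₁ d₂ : ℝ} {lam : 𝕜}
    {y : ℝ → 𝕜} (h : IsSolution q a α p r w c₁ c₂ d₁ d₂ lam y) :
    IsExtSolution q a α p r w c₁ c₂ d₁ d₂ lam y (quasiDeriv q a α p y) :=
  ⟨h.regular, fun _ _ => rfl, h.equation, h.bc_zero, h.bc_right⟩

/-- `λ` is an eigenvalue: there is a solution that does not vanish identically on `A*_{q,a}`. -/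
def IsEigenvalue (q a α : ℝ) (p r w : ℝ → ℝ) (c₁ c₂ d₁ d₂ : ℝ) (lam : 𝕜) : Prop :=
  ∃ y u : ℝ → 𝕜, IsExtSolution q a α p r w c₁ c₂ d₁ d₂ lam y u ∧ ∃ x ∈ gridZero q a, y x ≠ 0

/-- `λ` is a simple eigenvalue: it has an eigenfunction, and every solution is a constant multiple
of that eigenfunction on `A*_{q,a}`. -/
def IsSimpleEigenvalue (q a α : ℝ) (p r w : ℝ → ℝ) (c₁ c₂ d₁ d₂ : ℝ) (lam : 𝕜) : Prop :=
  ∃ y u : ℝ → 𝕜, IsExtSolution q a α p r w c₁ c₂ d₁ d₂ lam y u ∧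
    (∃ x ∈ gridZero q a, y x ≠ 0) ∧
    ∀ z v : ℝ → 𝕜, IsExtSolution q a α p r w c₁ c₂ d₁ d₂ lam z v →
      ∃ c : 𝕜, EqOn z (fun x => c * y x) (gridZero q a)

end Problem

end QFSL

end

/-!
On the grid `a q^n` both fractional integrals are discrete convolutions with the coefficients
`(q^ν; q)_k / (q; q)_k` of the `q`-binomial series, so their semigroup law is the product formula
for that series. With the semigroup law an extended solution `y` of the boundary value problem
satisfies `y = G ((r - λ w) y)` for the Green operator `G` of the unperturbed equation.
Cauchy–Schwarz for Jackson's integral bounds `G` from `L²_q` to the bounded functions by the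
reciprocal of the right side of the smallness condition. Under that condition
`y ↦ G ((r - λ w) y)` is therefore a strict contraction in the sup norm, and being linear it has
only the fixed point `0`: zero is the only extended solution, and `λ` is not an eigenvalue.
-/

noncomputable section

namespace QFSL

section Algebra

open PowerSeries

variable {K : Type*} [Field K] {q : K}

/-- The quotient `(A; q)_k / (q; q)_k` of finite `q`-shifted factorials, which is the `k`-th
coefficient of the `q`-binomial series. All kernels below are expressed through it. -/
def qBinomCoeff (q A : K) (k : ℕ) : K :=
  ∏ i ∈ Finset.range k, (1 - A * q ^ i) / (1 - q ^ (i + 1))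

/-- The formal `q`-binomial series `∑ (A; q)_k / (q; q)_k X ^ k`. -/
def qBinomSeries (q A : K) : PowerSeries K := PowerSeries.mk (qBinomCoeff q A)

@[simp]
theorem qBinomCoeff_zero (A : K) : qBinomCoeff q A 0 = 1 := by simp [qBinomCoeff]

theorem qBinomCoeff_succ_mul (hq : ∀ k : ℕ, q ^ (k + 1) ≠ 1) (A : K) (k : ℕ) :
    qBinomCoeff q A (k + 1) * (1 - q ^ (k + 1)) = qBinomCoeff q A k * (1 - A * q ^ k) := by
  rw [qBinomCoeff, Finset.prod_range_succ, mul_assoc,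
    div_mul_cancel₀ _ (sub_ne_zero_of_ne (hq k).symm), qBinomCoeff]

theorem constantCoeff_rescale (A : K) (f : PowerSeries K) :
    constantCoeff (rescale A f) = constantCoeff f := by
  rw [← coeff_zero_eq_constantCoeff_apply, coeff_rescale, pow_zero, one_mul,
    coeff_zero_eq_constantCoeff_apply]

theorem rescale_C (A B : K) : rescale A (C B) = C B := by
  ext (_ | n) <;> simp [coeff_rescale]

theorem one_sub_X_mul_eq_iff {A : K} {f : PowerSeries K} :
    (1 - X) * f = (1 - C A * X) * rescale q f ↔
      ∀ n, coeff (n + 1) f * (1 - q ^ (n + 1)) = coeff n f * (1 - A * q ^ n) := by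
  have key (n : ℕ) : coeff (n + 1) ((1 - X) * f) = coeff (n + 1) ((1 - C A * X) * rescale q f) ↔
      coeff (n + 1) f * (1 - q ^ (n + 1)) = coeff n f * (1 - A * q ^ n) := by
    simp only [sub_mul, one_mul, mul_assoc, map_sub, coeff_succ_X_mul, coeff_C_mul, coeff_rescale]
    constructor <;> intro h <;> linear_combination h
  refine ⟨fun h n => (key n).1 (by rw [h]), fun h => ?_⟩
  ext (_ | n)
  · simp [sub_mul, mul_assoc, constantCoeff_rescale]
  · exact (key n).2 (h n)

theorem one_sub_X_mul_qBinomSeries (hq : ∀ k : ℕ, q ^ (k + 1) ≠ 1) (A : K) :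
    (1 - X) * qBinomSeries q A = (1 - C A * X) * rescale q (qBinomSeries q A) :=
  one_sub_X_mul_eq_iff.2 fun n => by simpa [qBinomSeries] using qBinomCoeff_succ_mul hq A n

theorem eq_qBinomSeries (hq : ∀ k : ℕ, q ^ (k + 1) ≠ 1) {A : K} {f : PowerSeries K}
    (h₀ : constantCoeff f = 1) (hf : (1 - X) * f = (1 - C A * X) * rescale q f) :
    f = qBinomSeries q A := by
  rw [one_sub_X_mul_eq_iff] at hf
  ext n
  rw [qBinomSeries, coeff_mk]
  induction n with
  | zero => simpa using h₀
  | succ n ih =>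
    refine mul_right_cancel₀ (sub_ne_zero_of_ne (hq n).symm) ?_
    rw [hf, ih, qBinomCoeff_succ_mul hq]

theorem qBinomSeries_mul_rescale (hq : ∀ k : ℕ, q ^ (k + 1) ≠ 1) (A B : K) :
    qBinomSeries q A * rescale A (qBinomSeries q B) = qBinomSeries q (A * B) := by
  refine eq_qBinomSeries hq (by simp [qBinomSeries, constantCoeff_rescale]) ?_
  have hA := one_sub_X_mul_qBinomSeries hq A
  have hB : (1 - C A * X) * rescale A (qBinomSeries q B) =
      (1 - C (A * B) * X) * rescale q (rescale A (qBinomSeries q B)) := by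
    have h := congrArg (rescale A) (one_sub_X_mul_qBinomSeries hq B)
    simp only [map_mul, map_sub, map_one, rescale_X, rescale_rescale, rescale_C] at h ⊢
    rw [mul_comm A q, h, mul_left_comm, mul_assoc]
  rw [map_mul (rescale q)]
  linear_combination rescale A (qBinomSeries q B) * hA + rescale q (qBinomSeries q A) * hB

theorem sum_antidiagonal_qBinomCoeff (hq : ∀ k : ℕ, q ^ (k + 1) ≠ 1) (A B : K) (n : ℕ) :
    ∑ ij ∈ Finset.HasAntidiagonal.antidiagonal n,
      qBinomCoeff q A ij.1 * (A ^ ij.2 * qBinomCoeff q B ij.2) = qBinomCoeff q (A * B) n := by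
  simpa [coeff_mul, coeff_rescale, qBinomSeries] using
    congrArg (coeff n) (qBinomSeries_mul_rescale hq A B)

theorem qBinomCoeff_self (hq : ∀ k : ℕ, q ^ (k + 1) ≠ 1) (k : ℕ) : qBinomCoeff q q k = 1 :=
  Finset.prod_eq_one fun i _ => by
    rw [← pow_succ', div_self (sub_ne_zero_of_ne (hq i).symm)]

theorem qBinomCoeff_one_succ (k : ℕ) : qBinomCoeff q (1 : K) (k + 1) = 0 :=
  Finset.prod_eq_zero (Finset.mem_range.2 k.succ_pos) (by simp)

theorem sum_range_pow_mul_qBinomCoeff (hq : ∀ k : ℕ, q ^ (k + 1) ≠ 1) (A : K) (n : ℕ) :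
    ∑ k ∈ Finset.range (n + 1), q ^ k * qBinomCoeff q A k = qBinomCoeff q (q * A) n := by
  rw [← sum_antidiagonal_qBinomCoeff hq, Finset.Nat.sum_antidiagonal_eq_sum_range_succ_mk,
    ← Finset.sum_range_reflect]
  refine Finset.sum_congr rfl fun k _ => ?_
  have : n + 1 - 1 - k = n - k := rfl
  rw [qBinomCoeff_self hq, one_mul, this]

end Algebra

section Pochhammer

variable {q : ℝ}

theorem summable_neg_mul_pow (hq₀ : 0 < q) (hq₁ : q < 1) (z : ℝ) :
    Summable fun k : ℕ => -(z * q ^ k) :=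
  ((summable_geometric_of_lt_one hq₀.le hq₁).mul_left z).neg

theorem multipliable_qPochInf (hq₀ : 0 < q) (hq₁ : q < 1) (z : ℝ) :
    Multipliable fun k : ℕ => 1 - z * q ^ k := by
  simpa only [sub_eq_add_neg] using
    Real.multipliable_one_add_of_summable (summable_neg_mul_pow hq₀ hq₁ z)

theorem tendsto_qPochInf (hq₀ : 0 < q) (hq₁ : q < 1) (z : ℝ) :
    Tendsto (fun n => ∏ k ∈ Finset.range n, (1 - z * q ^ k)) atTop (𝓝 (qPochInf q z)) :=
  (multipliable_qPochInf hq₀ hq₁ z).hasProd.tendsto_prod_nat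

theorem qPochInf_eq_prod_mul (hq₀ : 0 < q) (hq₁ : q < 1) (z : ℝ) (n : ℕ) :
    qPochInf q z = (∏ k ∈ Finset.range n, (1 - z * q ^ k)) * qPochInf q (z * q ^ n) := by
  have hshift (k : ℕ) : 1 - z * q ^ (k + n) = 1 - z * q ^ n * q ^ k := by ring
  have htail : Multipliable fun k => 1 - z * q ^ (k + n) :=
    (multipliable_qPochInf hq₀ hq₁ (z * q ^ n)).congr fun k => (hshift k).symm
  have hsplit := Multipliable.prod_mul_tprod_nat_mul' (f := fun k => 1 - z * q ^ k) htail
  exact hsplit.symm.trans (congrArg _ (tprod_congr hshift))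

theorem mul_pow_lt_one (hq₀ : 0 < q) (hq₁ : q < 1) {z : ℝ} (hz : z < 1) (k : ℕ) :
    z * q ^ k < 1 := by
  have h₀ : 0 < q ^ k := pow_pos hq₀ k
  have h₁ : q ^ k ≤ 1 := pow_le_one₀ hq₀.le hq₁.le
  nlinarith

theorem one_sub_mul_pow_pos (hq₀ : 0 < q) (hq₁ : q < 1) {z : ℝ} (hz : z < 1) (k : ℕ) :
    0 < 1 - z * q ^ k :=
  sub_pos.2 (mul_pow_lt_one hq₀ hq₁ hz k)

theorem pow_succ_ne_one (hq₀ : 0 < q) (hq₁ : q < 1) (k : ℕ) : q ^ (k + 1) ≠ 1 :=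
  (pow_lt_one₀ hq₀.le hq₁ k.succ_ne_zero).ne

theorem qPochInf_pos (hq₀ : 0 < q) (hq₁ : q < 1) {z : ℝ} (hz : z < 1) : 0 < qPochInf q z := by
  refine lt_of_le_of_ne (ge_of_tendsto' (tendsto_qPochInf hq₀ hq₁ z) fun n =>
    Finset.prod_nonneg fun k _ => (one_sub_mul_pow_pos hq₀ hq₁ hz k).le) (Ne.symm ?_)
  have h := tprod_one_add_ne_zero_of_summable (R := ℝ) (f := fun k : ℕ => -(z * q ^ k))
    (fun k => by linarith [one_sub_mul_pow_pos hq₀ hq₁ hz k])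
    (summable_neg_mul_pow hq₀ hq₁ z).norm
  simpa only [qPochInf, sub_eq_add_neg] using h

theorem qPochInf_le_one_sub (hq₀ : 0 < q) (hq₁ : q < 1) {z : ℝ} (hz₀ : 0 ≤ z) (hz : z < 1) :
    qPochInf q z ≤ 1 - z := by
  have htail : qPochInf q (z * q) ≤ 1 :=
    le_of_tendsto' (tendsto_qPochInf hq₀ hq₁ (z * q)) fun n => Finset.prod_le_one
      (fun k _ => (one_sub_mul_pow_pos hq₀ hq₁ (by nlinarith) k).le)
      fun k _ => sub_le_self 1 (by positivity)
  simpa [qPochInf_eq_prod_mul hq₀ hq₁ z 1] using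
    mul_le_of_le_one_right (sub_nonneg.2 hz.le) htail

theorem qPochInf_eq_zero {z : ℝ} (k : ℕ) (hz : z * q ^ k = 1) : qPochInf q z = 0 :=
  tprod_of_exists_eq_zero ⟨k, by rw [hz, sub_self]⟩

theorem qPochInf_zero : qPochInf q 0 = 1 := by simp [qPochInf]

theorem qBinomCoeff_pos (hq₀ : 0 < q) (hq₁ : q < 1) {A : ℝ} (hA : A < 1) (k : ℕ) :
    0 < qBinomCoeff q A k :=
  Finset.prod_pos fun i _ => div_pos (one_sub_mul_pow_pos hq₀ hq₁ hA i)
    (sub_pos.2 (pow_lt_one₀ hq₀.le hq₁ i.succ_ne_zero))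

theorem qBinomCoeff_le_one (hq₀ : 0 < q) (hq₁ : q < 1) {A : ℝ} (hqA : q ≤ A) (hA : A < 1)
    (k : ℕ) : qBinomCoeff q A k ≤ 1 := by
  have hden (i : ℕ) : 0 < 1 - q ^ (i + 1) := sub_pos.2 (pow_lt_one₀ hq₀.le hq₁ i.succ_ne_zero)
  refine Finset.prod_le_one (fun i _ => div_nonneg (one_sub_mul_pow_pos hq₀ hq₁ hA i).le
    (hden i).le) fun i _ => (div_le_one (hden i)).2 ?_
  rw [pow_succ']
  gcongr

theorem tendsto_qBinomCoeff (hq₀ : 0 < q) (hq₁ : q < 1) (A : ℝ) :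
    Tendsto (qBinomCoeff q A) atTop (𝓝 (qPochInf q A / qPochInf q q)) := by
  refine ((tendsto_qPochInf hq₀ hq₁ A).div (tendsto_qPochInf hq₀ hq₁ q)
    (qPochInf_pos hq₀ hq₁ hq₁).ne').congr fun n => ?_
  simp only [Pi.div_apply, qBinomCoeff, Finset.prod_div_distrib, pow_succ']

theorem summable_qBinomCoeff_mul_pow (hq₀ : 0 < q) (hq₁ : q < 1) (A : ℝ) {z : ℝ}
    (hz : |z| < 1) : Summable fun k => qBinomCoeff q A k * z ^ k := by
  obtain ⟨C, hC⟩ := (tendsto_qBinomCoeff hq₀ hq₁ A).norm.bddAbove_range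
  refine .of_norm_bounded ((summable_geometric_of_lt_one (abs_nonneg z) hz).mul_left C) fun k => ?_
  rw [norm_mul, norm_pow, Real.norm_eq_abs z]
  gcongr
  exact hC ⟨k, rfl⟩

theorem one_sub_mul_tsum_qBinomCoeff (hq₀ : 0 < q) (hq₁ : q < 1) (A : ℝ) {z : ℝ}
    (hz : |z| < 1) :
    (1 - z) * ∑' k, qBinomCoeff q A k * z ^ k =
      (1 - A * z) * ∑' k, qBinomCoeff q A k * (z * q) ^ k := by
  have hzq : |z * q| < 1 := by
    rw [abs_mul, abs_of_pos hq₀]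
    nlinarith [abs_nonneg z]
  have hs := summable_qBinomCoeff_mul_pow hq₀ hq₁ A hz
  have hsq := summable_qBinomCoeff_mul_pow hq₀ hq₁ A hzq
  have hdiff : ∑' k, qBinomCoeff q A k * z ^ k - ∑' k, qBinomCoeff q A k * (z * q) ^ k =
      z * (∑' k, qBinomCoeff q A k * z ^ k) - A * z * ∑' k, qBinomCoeff q A k * (z * q) ^ k := by
    rw [← hs.tsum_sub hsq, (hs.sub hsq).tsum_eq_zero_add, ← tsum_mul_left, ← tsum_mul_left,
      ← (hs.mul_left z).tsum_sub (hsq.mul_left (A * z)), pow_zero, pow_zero, sub_self, zero_add]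
    refine tsum_congr fun k => ?_
    rw [mul_pow, mul_pow]
    linear_combination z ^ (k + 1) * qBinomCoeff_succ_mul (pow_succ_ne_one hq₀ hq₁) A k
  linear_combination hdiff

theorem tendsto_tsum_qBinomCoeff (hq₀ : 0 < q) (hq₁ : q < 1) (A : ℝ) {z : ℝ} (hz : |z| < 1) :
    Tendsto (fun n : ℕ => ∑' k, qBinomCoeff q A k * (z * q ^ n) ^ k) atTop (𝓝 1) := by
  have hzero : ∑' k, qBinomCoeff q A k * (0 : ℝ) ^ k = 1 := by
    rw [tsum_eq_single 0 fun k hk => by simp [hk]]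
    simp
  have harg : Tendsto (fun n : ℕ => z * q ^ n) atTop (𝓝 0) := by
    simpa using (tendsto_pow_atTop_nhds_zero_of_lt_one hq₀.le hq₁).const_mul z
  rw [← hzero]
  refine tendsto_tsum_of_dominated_convergence (summable_qBinomCoeff_mul_pow hq₀ hq₁ A hz).norm
    (fun k => (harg.pow k).const_mul _) (Eventually.of_forall fun n k => ?_)
  rw [norm_mul, norm_mul, norm_pow, norm_pow, norm_mul]
  gcongr
  exact mul_le_of_le_one_right (norm_nonneg z) (by
    rw [Real.norm_of_nonneg (by positivity)]
    exact pow_le_one₀ hq₀.le hq₁.le)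

theorem tsum_qBinomCoeff_mul_pow (hq₀ : 0 < q) (hq₁ : q < 1) (A : ℝ) {z : ℝ} (hz : |z| < 1) :
    ∑' k, qBinomCoeff q A k * z ^ k = qPochInf q (A * z) / qPochInf q z := by
  set F : ℝ → ℝ := fun z => ∑' k, qBinomCoeff q A k * z ^ k
  have hiter (n : ℕ) : (∏ k ∈ Finset.range n, (1 - z * q ^ k)) * F z =
      (∏ k ∈ Finset.range n, (1 - A * z * q ^ k)) * F (z * q ^ n) := by
    induction n with
    | zero => simp
    | succ n ih =>
      have hzn : |z * q ^ n| < 1 := by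
        rw [abs_mul, abs_of_pos (pow_pos hq₀ n)]
        exact mul_pow_lt_one hq₀ hq₁ hz n
      have hstep : (1 - z * q ^ n) * F (z * q ^ n) =
          (1 - A * (z * q ^ n)) * F (z * q ^ n * q) :=
        one_sub_mul_tsum_qBinomCoeff hq₀ hq₁ A hzn
      rw [Finset.prod_range_succ, Finset.prod_range_succ, mul_right_comm, ih, pow_succ,
        ← mul_assoc z]
      linear_combination (∏ k ∈ Finset.range n, (1 - A * z * q ^ k)) * hstep
  have hleft := (tendsto_qPochInf hq₀ hq₁ z).mul_const (F z)
  have hright := (tendsto_qPochInf hq₀ hq₁ (A * z)).mul (tendsto_tsum_qBinomCoeff hq₀ hq₁ A hz)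
  rw [eq_div_iff (qPochInf_pos hq₀ hq₁ (abs_lt.1 hz).2).ne', mul_comm]
  simpa using tendsto_nhds_unique hleft (hright.congr fun n => (hiter n).symm)

theorem qPoch_pow_succ (hq₀ : 0 < q) (hq₁ : q < 1) {ν : ℝ} (hν : 0 < ν) (k : ℕ) :
    qPoch q (q ^ (k + 1)) (ν - 1) = qPoch q q (ν - 1) * qBinomCoeff q (q ^ ν) k := by
  have hA : q ^ ν < 1 := Real.rpow_lt_one hq₀.le hq₁ hν
  have hexp (x : ℝ) : x * q * q ^ (ν - 1) = q ^ ν * x := by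
    rw [Real.rpow_sub_one hq₀.ne']
    field_simp
  have hnum := qPochInf_eq_prod_mul hq₀ hq₁ q k
  have hden := qPochInf_eq_prod_mul hq₀ hq₁ (q ^ ν) k
  have hnum₀ : ∏ i ∈ Finset.range k, (1 - q * q ^ i) ≠ 0 :=
    Finset.prod_ne_zero_iff.2 fun i _ => (one_sub_mul_pow_pos hq₀ hq₁ hq₁ i).ne'
  have hden₀ : ∏ i ∈ Finset.range k, (1 - q ^ ν * q ^ i) ≠ 0 :=
    Finset.prod_ne_zero_iff.2 fun i _ => (one_sub_mul_pow_pos hq₀ hq₁ hA i).ne'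
  have hself : q * q ^ (ν - 1) = q ^ ν := by simpa using hexp 1
  simp only [qPoch, qBinomCoeff, Finset.prod_div_distrib, hself, pow_succ, hexp]
  rw [hnum, hden, mul_comm (q ^ k) q]
  simp only [mul_comm _ q]
  field_simp

theorem qGamma_eq (hq₀ : 0 < q) (ν : ℝ) :
    qGamma q ν = qPoch q q (ν - 1) * (1 - q) ^ (1 - ν) := by
  rw [qGamma, qPoch, Real.rpow_sub_one hq₀.ne', mul_div_cancel₀ _ hq₀.ne']

theorem qPoch_self_pos (hq₀ : 0 < q) (hq₁ : q < 1) {ν : ℝ} (hν : 0 < ν) :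
    0 < qPoch q q (ν - 1) := by
  rw [qPoch, Real.rpow_sub_one hq₀.ne', mul_div_cancel₀ _ hq₀.ne']
  exact div_pos (qPochInf_pos hq₀ hq₁ hq₁)
    (qPochInf_pos hq₀ hq₁ (Real.rpow_lt_one hq₀.le hq₁ hν))

theorem qGamma_pos (hq₀ : 0 < q) (hq₁ : q < 1) {ν : ℝ} (hν : 0 < ν) : 0 < qGamma q ν := by
  rw [qGamma_eq hq₀]
  exact mul_pos (qPoch_self_pos hq₀ hq₁ hν) (Real.rpow_pos_of_pos (sub_pos.2 hq₁) _)

end Pochhammer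

section Series

variable {E : Type*} [NormedAddCommGroup E]

theorem hasSum_conditional_iff {f : ℕ → E} {s : E} :
    HasSum f s (SummationFilter.conditional ℕ) ↔
      Tendsto (fun n => ∑ k ∈ Finset.range n, f k) atTop (𝓝 s) := by
  rw [HasSum, SummationFilter.conditional_filter_eq_map_range, tendsto_map'_iff, Function.comp_def]

theorem tsum_conditional_eq {f : ℕ → E} (hf : Summable f) :
    ∑'[SummationFilter.conditional ℕ] n, f n = ∑' n, f n :=
  (hasSum_conditional_iff.2 hf.hasSum.tendsto_sum_nat).tsum_eq

theorem exists_norm_le_of_tendsto {Y : ℕ → E} {l : E} (hY : Tendsto Y atTop (𝓝 l)) :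
    ∃ M, ∀ n, ‖Y n‖ ≤ M :=
  hY.norm.bddAbove_range.imp fun _ hM n => hM ⟨n, rfl⟩

theorem hasSum_sum_antidiagonal [CompleteSpace E] {f : ℕ × ℕ → E} (hf : Summable f) :
    HasSum (fun n => ∑ ij ∈ Finset.HasAntidiagonal.antidiagonal n, f ij) (∑' x, f x) :=
  (Finset.HasAntidiagonal.sigmaAntidiagonalEquivProd.hasSum_iff.2 hf.hasSum).sigma fun n =>
    Finset.hasSum (Finset.HasAntidiagonal.antidiagonal n) f

variable [NormedSpace ℝ E]

theorem summation_by_parts (b : ℕ → ℝ) (Y : ℕ → E) (n : ℕ) :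
    ∑ k ∈ Finset.range n, (∑ j ∈ Finset.range (k + 1), b j) • (Y k - Y (k + 1)) =
      ∑ k ∈ Finset.range n, b k • Y k - (∑ k ∈ Finset.range n, b k) • Y n := by
  induction n with
  | zero => simp
  | succ n ih =>
    rw [Finset.sum_range_succ, ih, Finset.sum_range_succ b,
      Finset.sum_range_succ fun k => b k • Y k]
    module

variable [CompleteSpace E]

theorem summable_smul_of_norm_le {b : ℕ → ℝ} (hb : Summable b) {Y : ℕ → E} {M : ℝ}
    (hY : ∀ n, ‖Y n‖ ≤ M) : Summable fun k => b k • Y k := by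
  refine .of_norm_bounded (hb.norm.mul_right M) fun k => ?_
  rw [norm_smul]
  exact mul_le_mul_of_nonneg_left (hY k) (norm_nonneg _)

theorem tsum_conditional_summation_by_parts {b : ℕ → ℝ} (hb : Summable b) {Y : ℕ → E}
    (hY : Tendsto Y atTop (𝓝 0)) :
    ∑'[SummationFilter.conditional ℕ] k, (∑ j ∈ Finset.range (k + 1), b j) • (Y k - Y (k + 1)) =
      ∑' k, b k • Y k := by
  obtain ⟨M, hM⟩ := exists_norm_le_of_tendsto hY
  refine (hasSum_conditional_iff.2 ?_).tsum_eq
  simp only [summation_by_parts]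
  simpa using (summable_smul_of_norm_le hb hM).hasSum.tendsto_sum_nat.sub
    (hb.hasSum.tendsto_sum_nat.smul hY)

theorem tsum_smul_tsum_smul_add {b c : ℕ → ℝ} (hb : Summable b) (hc : Summable c) {Y : ℕ → E}
    {M : ℝ} (hY : ∀ n, ‖Y n‖ ≤ M) :
    ∑' j, b j • ∑' k, c k • Y (j + k) =
      ∑' n, (∑ ij ∈ Finset.HasAntidiagonal.antidiagonal n, b ij.1 * c ij.2) • Y n := by
  have hbc : Summable fun x : ℕ × ℕ => (b x.1 * c x.2) • Y (x.1 + x.2) := by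
    refine .of_norm_bounded ((hb.norm.mul_of_nonneg hc.norm (fun _ => norm_nonneg _)
      fun _ => norm_nonneg _).mul_right M) fun x => ?_
    rw [norm_smul, norm_mul]
    exact mul_le_mul_of_nonneg_left (hY _) (by positivity)
  calc ∑' j, b j • ∑' k, c k • Y (j + k)
      = ∑' x : ℕ × ℕ, (b x.1 * c x.2) • Y (x.1 + x.2) := by
        rw [hbc.tsum_prod]
        refine tsum_congr fun j => ?_
        rw [← (summable_smul_of_norm_le hc fun k => hY (j + k)).tsum_const_smul]
        simp only [mul_smul]
    _ = ∑' n, (∑ ij ∈ Finset.HasAntidiagonal.antidiagonal n, b ij.1 * c ij.2) • Y n := by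
        rw [← (hasSum_sum_antidiagonal hbc).tsum_eq]
        refine tsum_congr fun n => ?_
        rw [Finset.sum_smul]
        exact Finset.sum_congr rfl fun ij hij => by
          rw [Finset.HasAntidiagonal.mem_antidiagonal.1 hij]

theorem hasSum_sum_antidiagonal_smul {c : ℕ → ℝ} (hc : Summable c) {Y : ℕ → E}
    (hY : Summable fun k => ‖Y k‖) :
    HasSum (fun n => ∑ ij ∈ Finset.HasAntidiagonal.antidiagonal n, c ij.2 • Y ij.1)
      ((∑' k, c k) • ∑' k, Y k) := by
  have hcY : Summable fun x : ℕ × ℕ => c x.2 • Y x.1 := by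
    refine .of_norm ?_
    simpa only [norm_smul, mul_comm ‖c _‖] using hY.mul_of_nonneg hc.norm
      (fun _ => norm_nonneg _) fun _ => norm_nonneg _
  convert hasSum_sum_antidiagonal hcY using 1
  rw [hcY.tsum_prod, ← tsum_const_smul'']
  exact tsum_congr fun k => (hc.tsum_smul_const (Y k)).symm

end Series

section Left

variable {E : Type*} [NormedAddCommGroup E] [NormedSpace ℝ E] {q x μ ν : ℝ}

/-- The operator `I^ν_{q,0+}` written as a `q`-binomial series, which makes sense for every real
order `ν`; the order `-α` gives the Caputo derivative of functions vanishing at `0`. -/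
def leftSeries (q ν : ℝ) (f : ℝ → E) (x : ℝ) : E :=
  ((1 - q) * x) ^ ν • ∑' k : ℕ, (q ^ k * qBinomCoeff q (q ^ ν) k) • f (x * q ^ k)

/-- Absolute convergence of Jackson's integral `∫_0^x f d_q t`. -/
def QIntegrable (q x : ℝ) (f : ℝ → E) : Prop := Summable fun k : ℕ => q ^ k * ‖f (x * q ^ k)‖

omit [NormedSpace ℝ E] in
theorem QIntegrable.mul_pow (hq₀ : 0 < q) {f : ℝ → E} (hf : QIntegrable q x f) (n : ℕ) :
    QIntegrable q (x * q ^ n) f := by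
  refine (((summable_nat_add_iff n).2 hf).mul_left (q ^ n)⁻¹).congr fun k => ?_
  have := (pow_pos hq₀ n).ne'
  rw [mul_assoc x, ← pow_add, add_comm k n, pow_add, mul_assoc (q ^ n), inv_mul_cancel_left₀ this]

theorem pow_mul_mul_pow_rpow (hq₀ : 0 < q) (hx : 0 < x) (μ : ℝ) (k : ℕ) :
    q ^ k * (x * q ^ k) ^ μ = x ^ μ * (q ^ (μ + 1)) ^ k := by
  rw [Real.mul_rpow hx.le (pow_nonneg hq₀.le k), Real.rpow_add_one hq₀.ne', _root_.mul_pow,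
    Real.rpow_pow_comm hq₀.le]
  ring

omit [NormedSpace ℝ E] in
theorem QIntegrable.of_norm_le_rpow (hq₀ : 0 < q) (hq₁ : q < 1) (hx : 0 < x) (hμ : -1 < μ)
    {f : ℝ → E} {C : ℝ} (hf : ∀ k : ℕ, ‖f (x * q ^ k)‖ ≤ C * (x * q ^ k) ^ μ) :
    QIntegrable q x f := by
  have hgeom := summable_geometric_of_lt_one (Real.rpow_nonneg hq₀.le (μ + 1))
    (Real.rpow_lt_one hq₀.le hq₁ (by linarith))
  refine (hgeom.mul_left (C * x ^ μ)).of_nonneg_of_le (fun k => by positivity) fun k => ?_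
  calc q ^ k * ‖f (x * q ^ k)‖ ≤ q ^ k * (C * (x * q ^ k) ^ μ) := by gcongr; exact hf k
    _ = C * x ^ μ * (q ^ (μ + 1)) ^ k := by
      rw [mul_assoc C, ← pow_mul_mul_pow_rpow hq₀ hx]
      ring

theorem leftInt_eq_tsum_conditional (hq₀ : 0 < q) (hq₁ : q < 1) (hx : 0 < x) (hν : 0 < ν)
    (f : ℝ → E) :
    leftInt q ν f x = ((1 - q) * x) ^ ν •
      ∑'[SummationFilter.conditional ℕ] k : ℕ,
        (q ^ k * qBinomCoeff q (q ^ ν) k) • f (x * q ^ k) := by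
  have hq : 0 < 1 - q := sub_pos.2 hq₁
  have hkernel (k : ℕ) : q ^ k • qPoch q (q * (x * q ^ k) / x) (ν - 1) • f (x * q ^ k) =
      qPoch q q (ν - 1) • (q ^ k * qBinomCoeff q (q ^ ν) k) • f (x * q ^ k) := by
    have harg : q * (x * q ^ k) / x = q ^ (k + 1) := by
      rw [pow_succ']
      field_simp
    rw [harg, qPoch_pow_succ hq₀ hq₁ hν, smul_smul, smul_smul]
    ring_nf
  rw [leftInt, qInt, qIntZero, qIntZero, mul_zero, zero_smul, sub_zero]
  simp only [hkernel]
  rw [tsum_const_smul'', smul_smul, smul_smul, qGamma_eq hq₀]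
  congr 1
  have hpoch := (qPoch_self_pos hq₀ hq₁ hν).ne'
  have hpow := (Real.rpow_pos_of_pos hq ν).ne'
  rw [Real.rpow_sub_one hx.ne', Real.rpow_sub hq, Real.rpow_one, Real.mul_rpow hq.le hx.le]
  field_simp

theorem leftSeries_zero (f : ℝ → E) : leftSeries q 0 f x = f x := by
  rw [leftSeries, tsum_eq_single 0]
  · simp
  · rintro (_ | k) hk
    · exact absurd rfl hk
    · rw [Real.rpow_zero, qBinomCoeff_one_succ, mul_zero, zero_smul]

theorem leftSeries_rpow (hq₀ : 0 < q) (hq₁ : q < 1) (hx : 0 < x) (hμ : -1 < μ) (ν : ℝ) :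
    leftSeries q ν (fun t => t ^ μ) x =
      qGamma q (μ + 1) / qGamma q (ν + μ + 1) * x ^ (ν + μ) := by
  have hq : 0 < 1 - q := sub_pos.2 hq₁
  have hz : q ^ (μ + 1) < 1 := Real.rpow_lt_one hq₀.le hq₁ (by linarith)
  have hterm (k : ℕ) : (q ^ k * qBinomCoeff q (q ^ ν) k) • (x * q ^ k) ^ μ =
      x ^ μ * (qBinomCoeff q (q ^ ν) k * (q ^ (μ + 1)) ^ k) := by
    rw [smul_eq_mul, mul_right_comm, pow_mul_mul_pow_rpow hq₀ hx]
    ring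
  rw [leftSeries]
  simp only [hterm]
  rw [tsum_mul_left, tsum_qBinomCoeff_mul_pow hq₀ hq₁ _
    (by rwa [abs_of_nonneg (Real.rpow_nonneg hq₀.le _)]), smul_eq_mul, qGamma, qGamma,
    ← Real.rpow_add hq₀, ← add_assoc, Real.mul_rpow hq.le hx.le, Real.rpow_add hx,
    show 1 - (μ + 1) = (1 - (ν + μ + 1)) + ν by ring, Real.rpow_add hq]
  have hself := (qPochInf_pos hq₀ hq₁ hq₁).ne'
  have hpow := (Real.rpow_pos_of_pos hq (1 - (ν + μ + 1))).ne'
  by_cases h : qPochInf q (q ^ (ν + μ + 1)) = 0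
  · simp [h]
  · field_simp

variable [CompleteSpace E]

theorem QIntegrable.summable_qBinomCoeff_smul (hq₀ : 0 < q) (hq₁ : q < 1) {f : ℝ → E}
    (hf : QIntegrable q x f) (A : ℝ) :
    Summable fun k : ℕ => (q ^ k * qBinomCoeff q A k) • f (x * q ^ k) := by
  obtain ⟨C, hC⟩ := exists_norm_le_of_tendsto (tendsto_qBinomCoeff hq₀ hq₁ A)
  refine .of_norm_bounded (hf.mul_left C) fun k => ?_
  rw [norm_smul, norm_mul, Real.norm_of_nonneg (pow_nonneg hq₀.le k), mul_comm (q ^ k), mul_assoc]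
  gcongr
  exact hC k

theorem leftInt_eq_leftSeries (hq₀ : 0 < q) (hq₁ : q < 1) (hx : 0 < x) (hν : 0 < ν) {f : ℝ → E}
    (hf : QIntegrable q x f) : leftInt q ν f x = leftSeries q ν f x := by
  rw [leftInt_eq_tsum_conditional hq₀ hq₁ hx hν,
    tsum_conditional_eq (hf.summable_qBinomCoeff_smul hq₀ hq₁ _), leftSeries]

theorem leftInt_sub (hq₀ : 0 < q) (hq₁ : q < 1) (hx : 0 < x) (hν : 0 < ν) {f g : ℝ → E}
    (hf : QIntegrable q x f) (hg : QIntegrable q x g) :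
    leftInt q ν (fun t => f t - g t) x = leftInt q ν f x - leftInt q ν g x := by
  have hsf := hf.summable_qBinomCoeff_smul hq₀ hq₁ (q ^ ν)
  have hsg := hg.summable_qBinomCoeff_smul hq₀ hq₁ (q ^ ν)
  have hfg := hsf.sub hsg
  simp only [← smul_sub] at hfg
  rw [leftInt_eq_leftSeries hq₀ hq₁ hx hν hf, leftInt_eq_leftSeries hq₀ hq₁ hx hν hg,
    leftInt_eq_tsum_conditional hq₀ hq₁ hx hν, tsum_conditional_eq hfg, leftSeries, leftSeries,
    ← smul_sub, ← hsf.tsum_sub hsg]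
  simp only [smul_sub]

omit [CompleteSpace E] in
theorem leftInt_smul_const (hq₀ : 0 < q) (hq₁ : q < 1) (hx : 0 < x) (hν : 0 < ν) {f : ℝ → ℝ}
    (hf : QIntegrable q x f) (e : E) :
    leftInt q ν (fun t => f t • e) x = leftInt q ν f x • e := by
  have hs := hf.summable_qBinomCoeff_smul hq₀ hq₁ (q ^ ν)
  have hse := hs.smul_const e
  simp only [smul_assoc] at hse
  rw [leftInt_eq_leftSeries hq₀ hq₁ hx hν hf, leftInt_eq_tsum_conditional hq₀ hq₁ hx hν,
    tsum_conditional_eq hse, leftSeries, smul_assoc, ← hs.tsum_smul_const]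
  simp only [smul_assoc]

theorem norm_leftInt_le (hq₀ : 0 < q) (hq₁ : q < 1) (hx : 0 < x) (hν : 0 < ν) (hμ : -1 < μ)
    {f : ℝ → E} {C : ℝ} (hf : ∀ k : ℕ, ‖f (x * q ^ k)‖ ≤ C * (x * q ^ k) ^ μ) :
    ‖leftInt q ν f x‖ ≤ C * (qGamma q (μ + 1) / qGamma q (ν + μ + 1) * x ^ (ν + μ)) := by
  have : 0 < 1 - q := sub_pos.2 hq₁
  have hrpow : QIntegrable q x fun t => t ^ μ :=
    .of_norm_le_rpow (C := 1) hq₀ hq₁ hx hμ fun k => by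
      rw [one_mul, Real.norm_of_nonneg (by positivity)]
  have hsum := (hrpow.summable_qBinomCoeff_smul hq₀ hq₁ (q ^ ν)).hasSum.mul_left C
  rw [leftInt_eq_leftSeries hq₀ hq₁ hx hν (.of_norm_le_rpow hq₀ hq₁ hx hμ hf),
    ← leftSeries_rpow hq₀ hq₁ hx hμ, leftSeries, leftSeries, norm_smul,
    Real.norm_of_nonneg (by positivity), smul_eq_mul, mul_left_comm]
  refine mul_le_mul_of_nonneg_left (tsum_of_norm_bounded hsum fun k => ?_) (by positivity)
  have hc := qBinomCoeff_pos hq₀ hq₁ (Real.rpow_lt_one hq₀.le hq₁ hν) k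
  rw [norm_smul, Real.norm_of_nonneg (by positivity), smul_eq_mul, mul_left_comm]
  exact mul_le_mul_of_nonneg_left (hf k) (by positivity)

omit [CompleteSpace E] in
theorem norm_leftSeries_le (hq₀ : 0 < q) (hq₁ : q < 1) (hx : 0 < x) {f : ℝ → E} {M : ℝ}
    (hf : ∀ k : ℕ, ‖f (x * q ^ k)‖ ≤ M) (ν : ℝ) :
    ‖leftSeries q ν f x‖ ≤
      (∑' k : ℕ, |q ^ k * qBinomCoeff q (q ^ ν) k|) * M * ((1 - q) * x) ^ ν := by
  have : 0 < 1 - q := sub_pos.2 hq₁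
  have hs := summable_qBinomCoeff_mul_pow hq₀ hq₁ (q ^ ν) (z := q) (by rwa [abs_of_pos hq₀])
  simp only [mul_comm (qBinomCoeff _ _ _)] at hs
  rw [leftSeries, norm_smul, Real.norm_of_nonneg (by positivity), mul_comm]
  refine mul_le_mul_of_nonneg_right (tsum_of_norm_bounded (hs.abs.hasSum.mul_right M) fun k => ?_)
    (by positivity)
  rw [norm_smul, Real.norm_eq_abs]
  exact mul_le_mul_of_nonneg_left (hf k) (abs_nonneg _)

theorem leftSeries_leftSeries (hq₀ : 0 < q) (hq₁ : q < 1) (hx : 0 < x) (hν : -1 < ν) {f : ℝ → E}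
    {M : ℝ} (hf : ∀ k : ℕ, ‖f (x * q ^ k)‖ ≤ M) (μ : ℝ) :
    leftSeries q μ (leftSeries q ν f) x = leftSeries q (μ + ν) f x := by
  have hq : 0 < 1 - q := sub_pos.2 hq₁
  have hz : |q ^ (ν + 1)| < 1 := by
    rw [abs_of_nonneg (Real.rpow_nonneg hq₀.le _)]
    exact Real.rpow_lt_one hq₀.le hq₁ (by linarith)
  have houter := summable_qBinomCoeff_mul_pow hq₀ hq₁ (q ^ μ) hz
  have hinner := summable_qBinomCoeff_mul_pow hq₀ hq₁ (q ^ ν) (z := q) (by rwa [abs_of_pos hq₀])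
  have hterm (j : ℕ) : (q ^ j * qBinomCoeff q (q ^ μ) j) • leftSeries q ν f (x * q ^ j) =
      ((1 - q) * x) ^ ν • (qBinomCoeff q (q ^ μ) j * (q ^ (ν + 1)) ^ j) •
        ∑' k, (qBinomCoeff q (q ^ ν) k * q ^ k) • f (x * q ^ (j + k)) := by
    have hpow := pow_mul_mul_pow_rpow hq₀ (mul_pos hq hx) ν j
    simp only [leftSeries, smul_smul, mul_assoc x, ← pow_add, mul_comm (q ^ _) (qBinomCoeff _ _ _)]
    congr 1
    rw [← mul_assoc (1 - q) x]
    linear_combination qBinomCoeff q (q ^ μ) j * hpow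
  have hcoeff (n : ℕ) : ∑ ij ∈ Finset.HasAntidiagonal.antidiagonal n,
      qBinomCoeff q (q ^ μ) ij.1 * (q ^ (ν + 1)) ^ ij.1 * (qBinomCoeff q (q ^ ν) ij.2 * q ^ ij.2) =
      q ^ n * qBinomCoeff q (q ^ (μ + ν)) n := by
    rw [add_comm μ ν, Real.rpow_add hq₀ ν μ, ← sum_antidiagonal_qBinomCoeff
      (pow_succ_ne_one hq₀ hq₁), ← Finset.Nat.sum_antidiagonal_swap, Finset.mul_sum]
    refine Finset.sum_congr rfl fun ij hij => ?_
    rw [← Finset.HasAntidiagonal.mem_antidiagonal.1 hij, Real.rpow_add_one hq₀.ne', pow_add,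
      _root_.mul_pow]
    simp only [Prod.fst_swap, Prod.snd_swap]
    ring
  rw [leftSeries]
  simp only [hterm]
  rw [tsum_const_smul'', tsum_smul_tsum_smul_add (Y := fun n => f (x * q ^ n)) houter hinner hf,
    smul_smul, ← Real.rpow_add (mul_pos hq hx), leftSeries]
  simp only [hcoeff]

theorem leftCaputo_eq_leftSeries {α : ℝ} (hq₀ : 0 < q) (hq₁ : q < 1) (hα : α < 1) (hx : 0 < x)
    {y : ℝ → E} (hy : Tendsto (fun n : ℕ => y (x * q ^ n)) atTop (𝓝 (y 0))) :
    leftCaputo q α y x = leftSeries q (-α) (fun t => y t - y 0) x := by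
  have hq : 0 < 1 - q := sub_pos.2 hq₁
  have hs := summable_qBinomCoeff_mul_pow hq₀ hq₁ (q ^ (-α)) (z := q) (by rwa [abs_of_pos hq₀])
  simp only [mul_comm (qBinomCoeff _ _ _)] at hs
  have hY : Tendsto (fun n : ℕ => y (x * q ^ n) - y 0) atTop (𝓝 0) := by
    simpa only [sub_self] using hy.sub_const (y 0)
  have hterm (k : ℕ) : (q ^ k * qBinomCoeff q (q ^ (1 - α)) k) • qDeriv q y (x * q ^ k) =
      ((1 - q) * x)⁻¹ • (∑ j ∈ Finset.range (k + 1), q ^ j * qBinomCoeff q (q ^ (-α)) j) •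
        ((y (x * q ^ k) - y 0) - (y (x * q ^ (k + 1)) - y 0)) := by
    have hden : q ^ k * (x * q ^ k - q * (x * q ^ k))⁻¹ = ((1 - q) * x)⁻¹ := by
      have := pow_pos hq₀ k
      rw [show x * q ^ k - q * (x * q ^ k) = (1 - q) * x * q ^ k by ring]
      field_simp
    rw [sum_range_pow_mul_qBinomCoeff (pow_succ_ne_one hq₀ hq₁), ← Real.rpow_one_add' hq₀.le
      (by linarith), ← sub_eq_add_neg, qDeriv, smul_smul, smul_smul, mul_right_comm, hden,
      sub_sub_sub_cancel_right, mul_left_comm q, ← pow_succ']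
  rw [leftCaputo, leftInt_eq_tsum_conditional hq₀ hq₁ hx (sub_pos.2 hα)]
  simp only [hterm]
  rw [tsum_const_smul'', tsum_conditional_summation_by_parts hs hY, leftSeries, smul_smul,
    sub_eq_neg_add 1 α, Real.rpow_add_one (mul_pos hq hx).ne',
    mul_inv_cancel_right₀ (mul_pos hq hx).ne']

theorem leftInt_leftCaputo {α : ℝ} (hq₀ : 0 < q) (hq₁ : q < 1) (hα₀ : 0 < α) (hα₁ : α < 1)
    (hx : 0 < x) {y : ℝ → E} (hy : Tendsto (fun n : ℕ => y (x * q ^ n)) atTop (𝓝 (y 0))) :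
    leftInt q α (leftCaputo q α y) x = y x - y 0 := by
  have hq : 0 < 1 - q := sub_pos.2 hq₁
  have hxk (k : ℕ) : 0 < x * q ^ k := by positivity
  obtain ⟨M, hM⟩ := exists_norm_le_of_tendsto (hy.sub_const (y 0))
  have hcaputo (k : ℕ) :
      leftCaputo q α y (x * q ^ k) = leftSeries q (-α) (fun t => y t - y 0) (x * q ^ k) := by
    refine leftCaputo_eq_leftSeries hq₀ hq₁ hα₁ (hxk k) ?_
    simpa only [mul_assoc, ← pow_add, add_comm k, Function.comp_def] using
      hy.comp (tendsto_add_atTop_nat k)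
  have hint : QIntegrable q x (leftCaputo q α y) := by
    refine .of_norm_le_rpow hq₀ hq₁ hx (μ := -α) (by linarith) (C :=
      (∑' k : ℕ, |q ^ k * qBinomCoeff q (q ^ (-α)) k|) * M * (1 - q) ^ (-α)) fun k => ?_
    rw [hcaputo, mul_assoc _ ((1 - q) ^ (-α)), ← Real.mul_rpow hq.le (hxk k).le]
    exact norm_leftSeries_le hq₀ hq₁ (hxk k) (fun j => by
      simpa only [mul_assoc, ← pow_add] using hM (k + j)) _
  rw [leftInt_eq_leftSeries hq₀ hq₁ hx hα₀ hint]
  calc leftSeries q α (leftCaputo q α y) x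
      = leftSeries q α (leftSeries q (-α) fun t => y t - y 0) x := by
        rw [leftSeries, leftSeries]
        simp only [hcaputo]
    _ = y x - y 0 := by
        rw [leftSeries_leftSeries hq₀ hq₁ hx (by linarith) hM, add_neg_cancel, leftSeries_zero]

end Left

section Right

variable {E : Type*} [NormedAddCommGroup E] [NormedSpace ℝ E] {q a μ ν : ℝ}

/-- The mass `(1 - q) a q^k` that Jackson's integral `∫_0^a` puts on the grid point `a q^k`. -/
def gridMass (q a : ℝ) (k : ℕ) : ℝ := (1 - q) * (a * q ^ k)

theorem gridMass_pos (hq₀ : 0 < q) (hq₁ : q < 1) (ha : 0 < a) (k : ℕ) : 0 < gridMass q a k :=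
  mul_pos (sub_pos.2 hq₁) (by positivity)

theorem gridMass_add_rpow (hq₀ : 0 < q) (hq₁ : q < 1) (ha : 0 < a) (i j : ℕ) (μ : ℝ) :
    gridMass q a (i + j) ^ μ = gridMass q a i ^ μ * (q ^ μ) ^ j := by
  rw [Real.rpow_pow_comm hq₀.le, ← Real.mul_rpow (gridMass_pos hq₀ hq₁ ha i).le (by positivity)]
  simp only [gridMass, pow_add, mul_assoc]

theorem qPoch_div_eq_zero (hq₀ : 0 < q) {x : ℝ} (hx : x ≠ 0) (k : ℕ) (ν : ℝ) :
    qPoch q (q * x / (q * x * q ^ k)) ν = 0 := by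
  rw [qPoch, qPochInf_eq_zero k, zero_div]
  have := hq₀.ne'
  field_simp

theorem rightInt_kernel_eq (hq₀ : 0 < q) (hq₁ : q < 1) (ha : 0 < a) (hν : 0 < ν) (i j : ℕ) :
    1 / qGamma q ν * ((1 - q) * a) * q ^ i * ((a * q ^ i) ^ (ν - 1) *
      qPoch q (q * (a * q ^ (i + j)) / (a * q ^ i)) (ν - 1)) =
      qBinomCoeff q (q ^ ν) j * gridMass q a i ^ ν := by
  have hq : 0 < 1 - q := sub_pos.2 hq₁
  have hx : 0 < a * q ^ i := by positivity
  have harg : q * (a * q ^ (i + j)) / (a * q ^ i) = q ^ (j + 1) := by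
    rw [pow_add, pow_succ']
    field_simp
  have hpoch := (qPoch_self_pos hq₀ hq₁ hν).ne'
  have hpow := (Real.rpow_pos_of_pos hq ν).ne'
  rw [harg, qPoch_pow_succ hq₀ hq₁ hν, qGamma_eq hq₀, Real.rpow_sub_one hx.ne',
    Real.rpow_sub hq, Real.rpow_one, gridMass, Real.mul_rpow hq.le hx.le]
  field_simp

theorem rightInt_grid (hq₀ : 0 < q) (hq₁ : q < 1) (ha : 0 < a) (hν : 0 < ν) (f : ℝ → E) (n : ℕ) :
    rightInt q a ν f (a * q ^ n) = ∑ ij ∈ Finset.HasAntidiagonal.antidiagonal n,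
      (qBinomCoeff q (q ^ ν) ij.2 * gridMass q a ij.1 ^ ν) • f (a * q ^ ij.1) := by
  have hx : a * q ^ n ≠ 0 := by positivity
  have hlower : qIntZero q (q * (a * q ^ n)) (fun t =>
      (t ^ (ν - 1) * qPoch q (q * (a * q ^ n) / t) (ν - 1)) • f t) = 0 := by
    simp only [qIntZero, qPoch_div_eq_zero hq₀ hx, mul_zero, zero_smul, smul_zero, tsum_zero]
  have hzero (k : ℕ) (hk : k ∉ Finset.range (n + 1)) : q ^ k • (((a * q ^ k) ^ (ν - 1) *
      qPoch q (q * (a * q ^ n) / (a * q ^ k)) (ν - 1)) • f (a * q ^ k)) = 0 := by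
    obtain ⟨m, rfl⟩ := Nat.exists_eq_add_of_le (not_lt.1 (mt Finset.mem_range.2 hk))
    have harg : a * q ^ (n + 1 + m) = q * (a * q ^ n) * q ^ m := by ring
    rw [harg, qPoch_div_eq_zero hq₀ hx, mul_zero, zero_smul, smul_zero]
  rw [rightInt, qInt, hlower, sub_zero, qIntZero,
    tsum_conditional_eq (summable_of_ne_finset_zero hzero), tsum_eq_sum hzero,
    ← Finset.Nat.sum_antidiagonal_eq_sum_range_succ_mk (f := fun ij : ℕ × ℕ =>
      q ^ ij.1 • (((a * q ^ ij.1) ^ (ν - 1) *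
        qPoch q (q * (a * q ^ n) / (a * q ^ ij.1)) (ν - 1)) • f (a * q ^ ij.1))),
    smul_smul, Finset.smul_sum]
  refine Finset.sum_congr rfl fun ij hij => ?_
  rw [← Finset.HasAntidiagonal.mem_antidiagonal.1 hij, smul_smul, smul_smul,
    ← rightInt_kernel_eq hq₀ hq₁ ha hν]

theorem rightInt_zero (hq₀ : 0 < q) (hq₁ : q < 1) (ha : 0 < a) (ν : ℝ) (f : ℝ → E) :
    rightInt q a ν f 0 = (1 / qPoch q q (ν - 1)) •
      ∑'[SummationFilter.conditional ℕ] k : ℕ, gridMass q a k ^ ν • f (a * q ^ k) := by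
  have hq : 0 < 1 - q := sub_pos.2 hq₁
  have hpow := (Real.rpow_pos_of_pos hq ν).ne'
  have hkernel (k : ℕ) : q ^ k • (((a * q ^ k) ^ (ν - 1) *
      qPoch q (q * 0 / (a * q ^ k)) (ν - 1)) • f (a * q ^ k)) =
      (a⁻¹ * ((1 - q) ^ ν)⁻¹) • gridMass q a k ^ ν • f (a * q ^ k) := by
    have hx : 0 < a * q ^ k := by positivity
    have hpoch : qPoch q (q * 0 / (a * q ^ k)) (ν - 1) = 1 := by simp [qPoch, qPochInf_zero]
    rw [hpoch, Real.rpow_sub_one hx.ne', smul_smul, smul_smul, gridMass,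
      Real.mul_rpow hq.le hx.le]
    congr 1
    field_simp
  rw [rightInt, qInt, qIntZero, qIntZero]
  simp only [hkernel]
  rw [mul_zero, mul_zero, zero_smul, sub_zero, tsum_const_smul'', smul_smul, smul_smul,
    qGamma_eq hq₀, Real.rpow_sub hq, Real.rpow_one]
  congr 1
  field_simp

theorem rightInt_sub (hq₀ : 0 < q) (hq₁ : q < 1) (ha : 0 < a) (hν : 0 < ν) (f g : ℝ → E) (n : ℕ) :
    rightInt q a ν (fun t => f t - g t) (a * q ^ n) =
      rightInt q a ν f (a * q ^ n) - rightInt q a ν g (a * q ^ n) := by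
  simp only [rightInt_grid hq₀ hq₁ ha hν, smul_sub, Finset.sum_sub_distrib]

theorem rightInt_smul_const (hq₀ : 0 < q) (hq₁ : q < 1) (ha : 0 < a) (hν : 0 < ν) (f : ℝ → ℝ)
    (e : E) (n : ℕ) :
    rightInt q a ν (fun t => f t • e) (a * q ^ n) = rightInt q a ν f (a * q ^ n) • e := by
  simp only [rightInt_grid hq₀ hq₁ ha hν, Finset.sum_smul, smul_assoc]

theorem rightInt_rightInt_grid (hq₀ : 0 < q) (hq₁ : q < 1) (ha : 0 < a) (hμ : 0 < μ) (hν : 0 < ν)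
    (f : ℝ → E) (n : ℕ) :
    rightInt q a μ (rightInt q a ν f) (a * q ^ n) = rightInt q a (μ + ν) f (a * q ^ n) := by
  set c := fun (x : ℝ) => qBinomCoeff q (q ^ x)
  calc rightInt q a μ (rightInt q a ν f) (a * q ^ n)
      = ∑ mj ∈ Finset.HasAntidiagonal.antidiagonal n,
          ∑ ik ∈ Finset.HasAntidiagonal.antidiagonal mj.1,
          (gridMass q a ik.1 ^ (μ + ν) * (c μ mj.2 * ((q ^ μ) ^ ik.2 * c ν ik.2))) •
            f (a * q ^ ik.1) := by
        simp only [rightInt_grid hq₀ hq₁ ha hμ, rightInt_grid hq₀ hq₁ ha hν, Finset.smul_sum,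
          smul_smul]
        refine Finset.sum_congr rfl fun mj _ => Finset.sum_congr rfl fun ik hik => ?_
        rw [← Finset.HasAntidiagonal.mem_antidiagonal.1 hik, gridMass_add_rpow hq₀ hq₁ ha,
          Real.rpow_add (gridMass_pos hq₀ hq₁ ha _)]
        congr 1
        ring
    _ = ∑ il ∈ Finset.HasAntidiagonal.antidiagonal n,
          ∑ jk ∈ Finset.HasAntidiagonal.antidiagonal il.2,
          (gridMass q a il.1 ^ (μ + ν) * (c μ jk.1 * ((q ^ μ) ^ jk.2 * c ν jk.2))) •
            f (a * q ^ il.1) := by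
        rw [Finset.sum_sigma', Finset.sum_sigma']
        refine Finset.sum_nbij' (fun ⟨⟨_, j⟩, ⟨i, k⟩⟩ => ⟨(i, k + j), (j, k)⟩)
          (fun ⟨⟨i, _⟩, ⟨j, k⟩⟩ => ⟨(i + k, j), (i, k)⟩) ?_ ?_ ?_ ?_ ?_ <;>
        grind [Finset.HasAntidiagonal.mem_antidiagonal]
    _ = rightInt q a (μ + ν) f (a * q ^ n) := by
        simp only [rightInt_grid hq₀ hq₁ ha (add_pos hμ hν), Real.rpow_add hq₀,
          ← sum_antidiagonal_qBinomCoeff (pow_succ_ne_one hq₀ hq₁), Finset.sum_mul,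
          Finset.sum_smul, c]
        refine Finset.sum_congr rfl fun il _ => Finset.sum_congr rfl fun jk _ => ?_
        rw [mul_comm]

theorem eq_of_rightInt_eq (hq₀ : 0 < q) (hq₁ : q < 1) (ha : 0 < a) (hν : 0 < ν) {f g : ℝ → E}
    (h : ∀ n : ℕ, rightInt q a ν f (a * q ^ n) = rightInt q a ν g (a * q ^ n)) (n : ℕ) :
    f (a * q ^ n) = g (a * q ^ n) := by
  induction n using Nat.strong_induction_on with
  | _ n ih =>
    have hn := h n
    simp only [rightInt_grid hq₀ hq₁ ha hν, Finset.Nat.sum_antidiagonal_eq_sum_range_succ_mk,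
      Finset.sum_range_succ] at hn
    rw [Finset.sum_congr rfl fun k hk => by rw [ih k (Finset.mem_range.1 hk)]] at hn
    have hmass := (Real.rpow_pos_of_pos (gridMass_pos hq₀ hq₁ ha n) ν).ne'
    simpa [hmass] using hn

variable [CompleteSpace E]

theorem rightInt_rightInt_zero (hq₀ : 0 < q) (hq₁ : q < 1) (ha : 0 < a) (hμ : 0 < μ) (hν : 0 < ν)
    {f : ℝ → E} (hf : Summable fun k => ‖gridMass q a k ^ (μ + ν) • f (a * q ^ k)‖) :
    rightInt q a μ (rightInt q a ν f) 0 = rightInt q a (μ + ν) f 0 := by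
  have hz : |q ^ μ| < 1 := by
    rw [abs_of_nonneg (Real.rpow_nonneg hq₀.le _)]
    exact Real.rpow_lt_one hq₀.le hq₁ hμ
  have hterm (n : ℕ) : gridMass q a n ^ μ • rightInt q a ν f (a * q ^ n) =
      ∑ ij ∈ Finset.HasAntidiagonal.antidiagonal n, (qBinomCoeff q (q ^ ν) ij.2 * (q ^ μ) ^ ij.2) •
        gridMass q a ij.1 ^ (μ + ν) • f (a * q ^ ij.1) := by
    rw [rightInt_grid hq₀ hq₁ ha hν, Finset.smul_sum]
    refine Finset.sum_congr rfl fun ij hij => ?_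
    rw [← Finset.HasAntidiagonal.mem_antidiagonal.1 hij, gridMass_add_rpow hq₀ hq₁ ha,
      Real.rpow_add (gridMass_pos hq₀ hq₁ ha _), smul_smul, smul_smul]
    congr 1
    ring
  have hsum := hasSum_sum_antidiagonal_smul
    (summable_qBinomCoeff_mul_pow hq₀ hq₁ (q ^ ν) hz) hf
  have hinner : ∑'[SummationFilter.conditional ℕ] n, gridMass q a n ^ μ •
      rightInt q a ν f (a * q ^ n) = (∑' k, qBinomCoeff q (q ^ ν) k * (q ^ μ) ^ k) •
        ∑' k, gridMass q a k ^ (μ + ν) • f (a * q ^ k) := by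
    simp only [hterm]
    exact (tsum_conditional_eq hsum.summable).trans hsum.tsum_eq
  rw [rightInt_zero hq₀ hq₁ ha, rightInt_zero hq₀ hq₁ ha, hinner, tsum_conditional_eq hf.of_norm,
    tsum_qBinomCoeff_mul_pow hq₀ hq₁ _ hz, smul_smul, ← Real.rpow_add hq₀, add_comm ν μ]
  have hself := (qPochInf_pos hq₀ hq₁ hq₁).ne'
  have hpoch := (qPochInf_pos hq₀ hq₁ (Real.rpow_lt_one hq₀.le hq₁ hμ)).ne'
  congr 1
  simp only [qPoch, Real.rpow_sub_one hq₀.ne', mul_div_cancel₀ _ hq₀.ne']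
  field_simp

omit [CompleteSpace E] in
theorem rightInt_one_grid (hq₀ : 0 < q) (hq₁ : q < 1) (ha : 0 < a) (f : ℝ → E) (n : ℕ) :
    rightInt q a 1 f (a * q ^ n) =
      ∑ k ∈ Finset.range (n + 1), gridMass q a k • f (a * q ^ k) := by
  simp only [rightInt_grid hq₀ hq₁ ha one_pos, Real.rpow_one,
    qBinomCoeff_self (pow_succ_ne_one hq₀ hq₁), one_mul,
    Finset.Nat.sum_antidiagonal_eq_sum_range_succ_mk]

omit [CompleteSpace E] in
theorem rightInt_one_zero (hq₀ : 0 < q) (hq₁ : q < 1) (ha : 0 < a) {f : ℝ → E}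
    (hf : Summable fun k => gridMass q a k • f (a * q ^ k)) :
    rightInt q a 1 f 0 = ∑' k, gridMass q a k • f (a * q ^ k) := by
  have hself := (qPochInf_pos hq₀ hq₁ hq₁).ne'
  simp only [rightInt_zero hq₀ hq₁ ha, Real.rpow_one, tsum_conditional_eq hf]
  rw [qPoch, sub_self, Real.rpow_zero, mul_one, div_self hself, one_div_one, one_smul]

omit [CompleteSpace E] in
theorem rightInt_congr_zero (hq₀ : 0 < q) (hq₁ : q < 1) (ha : 0 < a) (ν : ℝ) {f g : ℝ → E}
    (h : ∀ n : ℕ, f (a * q ^ n) = g (a * q ^ n)) : rightInt q a ν f 0 = rightInt q a ν g 0 := by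
  simp only [rightInt_zero hq₀ hq₁ ha, h]

/-- The unit mass at `a` with respect to Jackson's integral `∫_0^a`. The free value `u (a / q)` of
an extended solution enters the equation as a multiple of it. -/
def unitMass (q a : ℝ) : ℝ → ℝ := Pi.single a ((1 - q) * a)⁻¹

theorem gridMass_mul_unitMass (hq₀ : 0 < q) (hq₁ : q < 1) (ha : 0 < a) (k : ℕ) :
    gridMass q a k * unitMass q a (a * q ^ k) = if k = 0 then 1 else 0 := by
  have hmass : (1 - q) * a ≠ 0 := (mul_pos (sub_pos.2 hq₁) ha).ne'
  rcases k with _ | k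
  · simpa [gridMass, unitMass] using mul_inv_cancel₀ hmass
  · have : a * q ^ (k + 1) ≠ a := by
      simpa [ha.ne'] using pow_succ_ne_one hq₀ hq₁ k
    simp [unitMass, this]

theorem rightInt_unitMass (hq₀ : 0 < q) (hq₁ : q < 1) (ha : 0 < a) (hν : 0 < ν) (n : ℕ) :
    rightInt q a ν (unitMass q a) (a * q ^ n) =
      qBinomCoeff q (q ^ ν) n * ((1 - q) * a) ^ (ν - 1) := by
  have hterm (ij : ℕ × ℕ) : (qBinomCoeff q (q ^ ν) ij.2 * gridMass q a ij.1 ^ ν) •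
      unitMass q a (a * q ^ ij.1) = if ij.1 = 0 then
        qBinomCoeff q (q ^ ν) ij.2 * ((1 - q) * a) ^ (ν - 1) else 0 := by
    have hmass := (gridMass_pos hq₀ hq₁ ha ij.1).ne'
    rw [← sub_add_cancel ν 1, Real.rpow_add_one hmass, sub_add_cancel, smul_eq_mul, mul_assoc,
      mul_assoc, gridMass_mul_unitMass hq₀ hq₁ ha]
    split_ifs with h
    · simp [h, gridMass]
    · simp
  simp only [rightInt_grid hq₀ hq₁ ha hν, hterm, Finset.Nat.sum_antidiagonal_eq_sum_range_succ_mk]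
  simp

end Right

section Estimates

variable {E F : Type*} [NormedAddCommGroup E] [NormedAddCommGroup F] {q a α β : ℝ}

theorem MemL2.summable_gridMass_mul {f : ℝ → E} (hf : MemL2 q a f) :
    Summable fun k => gridMass q a k * ‖f (a * q ^ k)‖ ^ 2 :=
  (hf.mul_left ((1 - q) * a)).congr fun k => by rw [gridMass]; ring

theorem normL2_eq_sqrt_tsum {f : ℝ → E} (hf : MemL2 q a f) :
    normL2 q a f = √(∑' k, gridMass q a k * ‖f (a * q ^ k)‖ ^ 2) := by
  simp only [normL2, qInt, qIntZero, smul_eq_mul]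
  rw [tsum_conditional_eq (f := fun k => q ^ k * ‖f (a * q ^ k)‖ ^ 2) hf, mul_zero, zero_mul,
    sub_zero, ← tsum_mul_left]
  simp only [gridMass, mul_assoc]

theorem normL2_nonneg (f : ℝ → E) : 0 ≤ normL2 q a f := Real.sqrt_nonneg _

theorem MemL2.of_norm_le (hq₀ : 0 < q) {f : ℝ → E} (hf : MemL2 q a f) {g : ℝ → F} {M : ℝ}
    (hg : ∀ k : ℕ, ‖g (a * q ^ k)‖ ≤ ‖f (a * q ^ k)‖ * M) : MemL2 q a g := by
  refine (hf.mul_right (M ^ 2)).of_nonneg_of_le (fun k => by positivity) fun k => ?_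
  rw [mul_assoc, ← mul_pow]
  gcongr
  exact hg k

theorem normL2_le_mul (hq₀ : 0 < q) (hq₁ : q < 1) (ha : 0 < a) {f : ℝ → E} (hf : MemL2 q a f)
    {g : ℝ → F} {M : ℝ} (hM : 0 ≤ M) (hg : ∀ k : ℕ, ‖g (a * q ^ k)‖ ≤ ‖f (a * q ^ k)‖ * M) :
    normL2 q a g ≤ normL2 q a f * M := by
  have hg₂ := hf.of_norm_le hq₀ hg
  rw [normL2_eq_sqrt_tsum hf, normL2_eq_sqrt_tsum hg₂, ← Real.sqrt_sq hM,
    ← Real.sqrt_mul' _ (sq_nonneg M), ← tsum_mul_right]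
  refine Real.sqrt_le_sqrt (hg₂.summable_gridMass_mul.tsum_le_tsum (fun k => ?_)
    (hf.summable_gridMass_mul.mul_right _))
  have hmass := gridMass_pos hq₀ hq₁ ha k
  rw [mul_assoc, ← mul_pow]
  gcongr
  exact hg k

theorem memL2_sub (hq₀ : 0 < q) {f g : ℝ → E} (hf : MemL2 q a f) (hg : MemL2 q a g) :
    MemL2 q a fun x => f x - g x := by
  refine ((hf.add hg).mul_left 2).of_nonneg_of_le (fun k => by positivity) fun k => ?_
  have hsq := (pow_le_pow_left₀ (norm_nonneg _)
    (norm_sub_le (f (a * q ^ k)) (g (a * q ^ k))) 2).trans add_sq_le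
  calc q ^ k * ‖f (a * q ^ k) - g (a * q ^ k)‖ ^ 2
      ≤ q ^ k * (2 * (‖f (a * q ^ k)‖ ^ 2 + ‖g (a * q ^ k)‖ ^ 2)) := by gcongr
    _ = 2 * (q ^ k * ‖f (a * q ^ k)‖ ^ 2 + q ^ k * ‖g (a * q ^ k)‖ ^ 2) := by ring

theorem sum_gridMass_rpow_mul_norm_le (hq₀ : 0 < q) (hq₁ : q < 1) (ha : 0 < a) {g : ℝ → E}
    (hg : MemL2 q a g) (α : ℝ) (s : Finset ℕ) :
    ∑ k ∈ s, gridMass q a k ^ α * ‖g (a * q ^ k)‖ ≤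
      √(∑ k ∈ s, gridMass q a k ^ (2 * α - 1)) * normL2 q a g := by
  have hmass := gridMass_pos hq₀ hq₁ ha
  have hsplit (k : ℕ) : gridMass q a k ^ (α - 1 / 2) * √(gridMass q a k) = gridMass q a k ^ α := by
    rw [Real.sqrt_eq_rpow, ← Real.rpow_add (hmass k), sub_add_cancel]
  have hsq (k : ℕ) : (gridMass q a k ^ (α - 1 / 2)) ^ 2 = gridMass q a k ^ (2 * α - 1) := by
    rw [← Real.rpow_mul_natCast (hmass k).le]
    ring_nf
  have hcs := Real.sum_mul_le_sqrt_mul_sqrt s (fun k => gridMass q a k ^ (α - 1 / 2))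
    fun k => √(gridMass q a k) * ‖g (a * q ^ k)‖
  simp only [← mul_assoc, hsplit, hsq, mul_pow, Real.sq_sqrt (hmass _).le] at hcs
  refine hcs.trans (mul_le_mul_of_nonneg_left ?_ (Real.sqrt_nonneg _))
  rw [normL2_eq_sqrt_tsum hg]
  exact Real.sqrt_le_sqrt (hg.summable_gridMass_mul.sum_le_tsum s fun k _ =>
    mul_nonneg (hmass k).le (sq_nonneg _))

theorem sum_range_mul_pow_le {c ρ : ℝ} (hc : 0 ≤ c) (hρ₀ : 0 ≤ ρ) (hρ₁ : ρ < 1) (n : ℕ) :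
    ∑ k ∈ Finset.range n, c * ρ ^ k ≤ c / (1 - ρ) := by
  rw [← Finset.mul_sum, div_eq_mul_inv, ← tsum_geometric_of_lt_one hρ₀ hρ₁]
  exact mul_le_mul_of_nonneg_left ((summable_geometric_of_lt_one hρ₀ hρ₁).sum_le_tsum _
    fun k _ => pow_nonneg hρ₀ k) hc

theorem sum_gridMass_rpow_le (hq₀ : 0 < q) (hq₁ : q < 1) (ha : 0 < a) (hβ : 0 < β) (n : ℕ) :
    ∑ k ∈ Finset.range n, gridMass q a k ^ β ≤ gridMass q a 0 ^ β / (1 - q ^ β) := by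
  have hpow (k : ℕ) : gridMass q a k ^ β = gridMass q a 0 ^ β * (q ^ β) ^ k := by
    rw [← gridMass_add_rpow hq₀ hq₁ ha, zero_add]
  rw [Finset.sum_congr rfl fun k _ => hpow k]
  exact sum_range_mul_pow_le (Real.rpow_nonneg (gridMass_pos hq₀ hq₁ ha 0).le β)
    (Real.rpow_nonneg hq₀.le β) (Real.rpow_lt_one hq₀.le hq₁ hβ) n

theorem sum_gridMass_rpow_le_of_neg (hq₀ : 0 < q) (hq₁ : q < 1) (ha : 0 < a) (hβ : β < 0) (n : ℕ) :
    ∑ k ∈ Finset.range (n + 1), gridMass q a k ^ β ≤ gridMass q a n ^ β / (1 - q ^ (-β)) := by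
  have hpow : ∀ k ∈ Finset.range (n + 1),
      gridMass q a (n - k) ^ β = gridMass q a n ^ β * (q ^ (-β)) ^ k := fun k hk => by
    obtain ⟨m, rfl⟩ := Nat.exists_eq_add_of_le' (Nat.lt_succ_iff.1 (Finset.mem_range.1 hk))
    have hqβ := (Real.rpow_pos_of_pos hq₀ β).ne'
    rw [Nat.add_sub_cancel, gridMass_add_rpow hq₀ hq₁ ha, Real.rpow_neg hq₀.le, inv_pow,
      mul_inv_cancel_right₀ (pow_ne_zero k hqβ)]
  rw [← Finset.sum_range_reflect, Nat.add_sub_cancel, Finset.sum_congr rfl hpow]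
  exact sum_range_mul_pow_le (Real.rpow_nonneg (gridMass_pos hq₀ hq₁ ha n).le β)
    (Real.rpow_nonneg hq₀.le _) (Real.rpow_lt_one hq₀.le hq₁ (neg_pos.2 hβ)) _

variable [NormedSpace ℝ E]

theorem sum_norm_gridMass_smul_le (hq₀ : 0 < q) (hq₁ : q < 1) (ha : 0 < a) {g : ℝ → E}
    (hg : MemL2 q a g) (n : ℕ) :
    ∑ k ∈ Finset.range n, ‖gridMass q a k • g (a * q ^ k)‖ ≤ √a * normL2 q a g := by
  have hcs := sum_gridMass_rpow_mul_norm_le hq₀ hq₁ ha hg 1 (Finset.range n)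
  have hsum := sum_gridMass_rpow_le hq₀ hq₁ ha one_pos n
  have hmass : gridMass q a 0 ^ (1 : ℝ) / (1 - q ^ (1 : ℝ)) = a := by
    have := (sub_pos.2 hq₁).ne'
    simp only [gridMass, Real.rpow_one, pow_zero]
    field_simp
  rw [hmass] at hsum
  norm_num only [Real.rpow_one] at hcs hsum
  simp only [norm_smul, Real.norm_of_nonneg (gridMass_pos hq₀ hq₁ ha _).le]
  exact hcs.trans (mul_le_mul_of_nonneg_right (Real.sqrt_le_sqrt hsum) (normL2_nonneg g))

theorem summable_norm_gridMass_smul (hq₀ : 0 < q) (hq₁ : q < 1) (ha : 0 < a) {g : ℝ → E}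
    (hg : MemL2 q a g) : Summable fun k => ‖gridMass q a k • g (a * q ^ k)‖ :=
  summable_of_sum_range_le (fun _ => norm_nonneg _) (sum_norm_gridMass_smul_le hq₀ hq₁ ha hg)

theorem norm_tsum_gridMass_smul_le (hq₀ : 0 < q) (hq₁ : q < 1) (ha : 0 < a) {g : ℝ → E}
    (hg : MemL2 q a g) : ‖∑' k, gridMass q a k • g (a * q ^ k)‖ ≤ √a * normL2 q a g :=
  have hsum := summable_norm_gridMass_smul hq₀ hq₁ ha hg
  (norm_tsum_le_tsum_norm hsum).trans
    (hsum.tsum_le_of_sum_range_le (sum_norm_gridMass_smul_le hq₀ hq₁ ha hg))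

theorem norm_rightInt_le (hq₀ : 0 < q) (hq₁ : q < 1) (ha : 0 < a) (hα₀ : 0 < α) (hα₁ : α < 1)
    {g : ℝ → E} (hg : MemL2 q a g) (n : ℕ) :
    ‖rightInt q a α g (a * q ^ n)‖ ≤
      √(∑ k ∈ Finset.range (n + 1), gridMass q a k ^ (2 * α - 1)) * normL2 q a g := by
  have hqα : q ≤ q ^ α := by
    simpa only [Real.rpow_one] using Real.rpow_le_rpow_of_exponent_ge hq₀ hq₁.le hα₁.le
  have hqα₁ := Real.rpow_lt_one hq₀.le hq₁ hα₀
  refine le_trans ?_ (sum_gridMass_rpow_mul_norm_le hq₀ hq₁ ha hg α _)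
  rw [rightInt_grid hq₀ hq₁ ha hα₀, Finset.Nat.sum_antidiagonal_eq_sum_range_succ_mk]
  refine norm_sum_le_of_le _ fun k _ => ?_
  have hmass := Real.rpow_nonneg (gridMass_pos hq₀ hq₁ ha k).le α
  rw [norm_smul, Real.norm_of_nonneg (mul_nonneg (qBinomCoeff_pos hq₀ hq₁ hqα₁ _).le hmass)]
  exact mul_le_mul_of_nonneg_right
    (mul_le_of_le_one_left hmass (qBinomCoeff_le_one hq₀ hq₁ hqα hqα₁ _)) (norm_nonneg _)

theorem norm_rightInt_le_of_half_lt (hq₀ : 0 < q) (hq₁ : q < 1) (ha : 0 < a) (hα : 1 / 2 < α)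
    (hα₁ : α < 1) {g : ℝ → E} (hg : MemL2 q a g) (n : ℕ) :
    ‖rightInt q a α g (a * q ^ n)‖ ≤
      ((1 - q) * a) ^ (α - 1 / 2) / √(1 - q ^ (2 * α - 1)) * normL2 q a g := by
  refine (norm_rightInt_le hq₀ hq₁ ha (by linarith) hα₁ hg n).trans
    (mul_le_mul_of_nonneg_right ?_ (normL2_nonneg g))
  have hmass := (gridMass_pos hq₀ hq₁ ha 0).le
  have hsqrt : √(gridMass q a 0 ^ (2 * α - 1)) = ((1 - q) * a) ^ (α - 1 / 2) := by
    rw [Real.sqrt_eq_rpow, ← Real.rpow_mul hmass, gridMass, pow_zero, mul_one]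
    ring_nf
  rw [← hsqrt, ← Real.sqrt_div (Real.rpow_nonneg hmass _)]
  exact Real.sqrt_le_sqrt (sum_gridMass_rpow_le hq₀ hq₁ ha (by linarith) _)

theorem norm_rightInt_le_of_lt_half (hq₀ : 0 < q) (hq₁ : q < 1) (ha : 0 < a) (hα₀ : 0 < α)
    (hα : α < 1 / 2) {g : ℝ → E} (hg : MemL2 q a g) (n : ℕ) :
    ‖rightInt q a α g (a * q ^ n)‖ ≤
      (1 - q) ^ (α - 1 / 2) / √(1 - q ^ (1 - 2 * α)) * normL2 q a g *
        (a * q ^ n) ^ (α - 1 / 2) := by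
  have hmass := (gridMass_pos hq₀ hq₁ ha n).le
  have hsqrt : √(gridMass q a n ^ (2 * α - 1)) =
      (1 - q) ^ (α - 1 / 2) * (a * q ^ n) ^ (α - 1 / 2) := by
    rw [Real.sqrt_eq_rpow, ← Real.rpow_mul hmass, gridMass,
      Real.mul_rpow (sub_pos.2 hq₁).le (by positivity)]
    ring_nf
  have hsum := sum_gridMass_rpow_le_of_neg hq₀ hq₁ ha (β := 2 * α - 1) (by linarith) n
  rw [neg_sub] at hsum
  calc ‖rightInt q a α g (a * q ^ n)‖
      ≤ √(gridMass q a n ^ (2 * α - 1) / (1 - q ^ (1 - 2 * α))) * normL2 q a g :=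
        (norm_rightInt_le hq₀ hq₁ ha hα₀ (by linarith) hg n).trans
          (mul_le_mul_of_nonneg_right (Real.sqrt_le_sqrt hsum) (normL2_nonneg g))
    _ = _ := by
        rw [Real.sqrt_div (Real.rpow_nonneg hmass _), hsqrt]
        ring

/-- The fractional Volterra operator `I^α_{q,0+} p⁻¹ I^α_{q,a-}`, the solution operator of
`D^α_{q,a-} (p ᶜD^α_{q,0+} y) = g` with vanishing data `y(0)` and `u(a / q)`. -/
def fracVolterra (q a α : ℝ) (p : ℝ → ℝ) (g : ℝ → E) : ℝ → E :=
  leftInt q α fun t => (p t)⁻¹ • rightInt q a α g t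

/-- `κ` is a constant for which `fracVolterra` maps `L²_q` into the bounded functions with norm at
most `a^(2α - 1/2) κ / m` whenever `|p| ≥ m` on the grid. -/
structure IsVolterraConst (E : Type*) [NormedAddCommGroup E] [NormedSpace ℝ E]
    (q a α κ : ℝ) : Prop where
  integrable {p : ℝ → ℝ} {m : ℝ} {g : ℝ → E} : 0 < m → (∀ n : ℕ, m ≤ |p (a * q ^ n)|) →
    MemL2 q a g → QIntegrable q a fun t => (p t)⁻¹ • rightInt q a α g t
  norm_le {p : ℝ → ℝ} {m : ℝ} {g : ℝ → E} : 0 < m → (∀ n : ℕ, m ≤ |p (a * q ^ n)|) →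
    MemL2 q a g → ∀ n : ℕ,
      ‖fracVolterra q a α p g (a * q ^ n)‖ ≤ a ^ (2 * α - 1 / 2) * κ / m * normL2 q a g

theorem norm_inv_smul_le {m s C t : ℝ} {v : E} (hm : 0 < m) (hs : m ≤ |s|) (hv : ‖v‖ ≤ C * t) :
    ‖s⁻¹ • v‖ ≤ C / m * t := by
  rw [norm_smul, norm_inv, Real.norm_eq_abs, inv_mul_eq_div, div_mul_eq_mul_div]
  exact div_le_div₀ ((norm_nonneg v).trans hv) hv hm hs

theorem IsVolterraConst.of_norm_rightInt_le [CompleteSpace E] {μ C κ : ℝ} (hq₀ : 0 < q)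
    (hq₁ : q < 1) (ha : 0 < a) (hα : 0 < α) (hμ : -1 < μ) (hαμ : 0 ≤ α + μ) (hC : 0 ≤ C)
    (hright : ∀ g : ℝ → E, MemL2 q a g → ∀ n : ℕ,
      ‖rightInt q a α g (a * q ^ n)‖ ≤ C * normL2 q a g * (a * q ^ n) ^ μ)
    (hκ : C * (qGamma q (μ + 1) / qGamma q (α + μ + 1) * a ^ (α + μ)) ≤ a ^ (2 * α - 1 / 2) * κ) :
    IsVolterraConst E q a α κ := by
  have hΓ : 0 ≤ qGamma q (μ + 1) / qGamma q (α + μ + 1) :=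
    div_nonneg (qGamma_pos hq₀ hq₁ (by linarith)).le (qGamma_pos hq₀ hq₁ (by linarith)).le
  refine ⟨fun hm hp hg => .of_norm_le_rpow hq₀ hq₁ ha hμ fun n =>
    norm_inv_smul_le hm (hp n) (hright _ hg n), fun {p m g} hm hp hg n => ?_⟩
  have hN := normL2_nonneg (q := q) (a := a) g
  have hmono : (a * q ^ n) ^ (α + μ) ≤ a ^ (α + μ) :=
    Real.rpow_le_rpow (by positivity)
      (mul_le_of_le_one_right ha.le (pow_le_one₀ hq₀.le hq₁.le)) hαμ
  calc ‖fracVolterra q a α p g (a * q ^ n)‖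
      ≤ C * normL2 q a g / m *
          (qGamma q (μ + 1) / qGamma q (α + μ + 1) * (a * q ^ n) ^ (α + μ)) := by
        refine norm_leftInt_le hq₀ hq₁ (by positivity) hα hμ fun k => ?_
        rw [mul_assoc a, ← pow_add]
        exact norm_inv_smul_le hm (hp _) (hright g hg _)
    _ ≤ C * normL2 q a g / m * (qGamma q (μ + 1) / qGamma q (α + μ + 1) * a ^ (α + μ)) := by
        gcongr
    _ = C * (qGamma q (μ + 1) / qGamma q (α + μ + 1) * a ^ (α + μ)) / m * normL2 q a g := by ring
    _ ≤ a ^ (2 * α - 1 / 2) * κ / m * normL2 q a g := by gcongr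

theorem qPochInf_le_one (hq₀ : 0 < q) (hq₁ : q < 1) {z : ℝ} (hz₀ : 0 ≤ z) (hz : z < 1) :
    qPochInf q z ≤ 1 :=
  (qPochInf_le_one_sub hq₀ hq₁ hz₀ hz).trans (sub_le_self 1 hz₀)

theorem qPochInf_self_le_qGamma_add_one (hq₀ : 0 < q) (hq₁ : q < 1) (hα : 0 < α) :
    qPochInf q q ≤ qGamma q (α + 1) := by
  have hself := (qPochInf_pos hq₀ hq₁ hq₁).le
  have hz := Real.rpow_lt_one hq₀.le hq₁ (by linarith : 0 < α + 1)
  have hpow : 1 ≤ (1 - q) ^ (1 - (α + 1)) :=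
    Real.one_le_rpow_of_pos_of_le_one_of_nonpos (sub_pos.2 hq₁) (by linarith) (by linarith)
  have hdiv : qPochInf q q ≤ qPochInf q q / qPochInf q (q ^ (α + 1)) :=
    le_div_self hself (qPochInf_pos hq₀ hq₁ hz)
      (qPochInf_le_one hq₀ hq₁ (Real.rpow_nonneg hq₀.le _) hz)
  exact hdiv.trans (le_mul_of_one_le_right (hself.trans hdiv) hpow)

theorem qGamma_one (hq₀ : 0 < q) (hq₁ : q < 1) : qGamma q 1 = 1 := by
  rw [qGamma, Real.rpow_one, sub_self, Real.rpow_zero, mul_one,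
    div_self (qPochInf_pos hq₀ hq₁ hq₁).ne']

theorem isVolterraConst_cConst [CompleteSpace E] (hq₀ : 0 < q) (hq₁ : q < 1) (ha : 0 < a)
    (hα : 1 / 2 < α) (hα₁ : α < 1) : IsVolterraConst E q a α (cConst q α) := by
  have hq : 0 < 1 - q := sub_pos.2 hq₁
  have hα₀ : 0 < α := by linarith
  have hself := qPochInf_pos hq₀ hq₁ hq₁
  refine .of_norm_rightInt_le (μ := 0) (C := ((1 - q) * a) ^ (α - 1 / 2) / √(1 - q ^ (2 * α - 1)))
    hq₀ hq₁ ha hα₀ (by norm_num) (by linarith) (by positivity) (fun g hg n => ?_) ?_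
  · rw [Real.rpow_zero, mul_one]
    exact norm_rightInt_le_of_half_lt hq₀ hq₁ ha hα hα₁ hg n
  · have hexp : a ^ (2 * α - 1 / 2) = a ^ (α - 1 / 2) * a ^ α := by
      rw [← Real.rpow_add ha]
      ring_nf
    rw [zero_add, add_zero, qGamma_one hq₀ hq₁, one_div (qGamma q (α + 1)),
      Real.mul_rpow hq.le ha.le]
    calc (1 - q) ^ (α - 1 / 2) * a ^ (α - 1 / 2) / √(1 - q ^ (2 * α - 1)) *
          ((qGamma q (α + 1))⁻¹ * a ^ α)
        ≤ (1 - q) ^ (α - 1 / 2) * a ^ (α - 1 / 2) / √(1 - q ^ (2 * α - 1)) *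
          ((qPochInf q q)⁻¹ * a ^ α) := by
          gcongr
          exact qPochInf_self_le_qGamma_add_one hq₀ hq₁ hα₀
      _ = a ^ (2 * α - 1 / 2) * cConst q α := by
          rw [hexp, cConst]
          field_simp

theorem isVolterraConst_gammaConst [CompleteSpace E] (hq₀ : 0 < q) (hq₁ : q < 1) (ha : 0 < a)
    (hα : 1 / 4 ≤ α) (hα₁ : α < 1 / 2) : IsVolterraConst E q a α (gammaConst q α) := by
  have hq : 0 < 1 - q := sub_pos.2 hq₁
  have hα₀ : 0 < α := by linarith
  have hqα := Real.rpow_lt_one hq₀.le hq₁ hα₀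
  have hpoch := qPochInf_pos hq₀ hq₁ hqα
  refine .of_norm_rightInt_le (μ := α - 1 / 2)
    (C := (1 - q) ^ (α - 1 / 2) / √(1 - q ^ (1 - 2 * α))) hq₀ hq₁ ha hα₀ (by linarith)
    (by linarith) (by positivity)
    (fun g hg n => norm_rightInt_le_of_lt_half hq₀ hq₁ ha hα₀ hα₁ hg n) ?_
  have hpow : (1 - q) ^ (α - 1 / 2) ≤ √(1 - q) / qPochInf q (q ^ α) := by
    have hle : qPochInf q (q ^ α) ≤ (1 - q) ^ (1 - α) :=
      calc qPochInf q (q ^ α) ≤ 1 - q ^ α :=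
            qPochInf_le_one_sub hq₀ hq₁ (Real.rpow_nonneg hq₀.le α) hqα
        _ ≤ 1 - q ^ (1 : ℝ) := sub_le_sub_left
            (Real.rpow_le_rpow_of_exponent_ge hq₀ hq₁.le (by linarith)) 1
        _ = (1 - q) ^ (1 : ℝ) := by rw [Real.rpow_one, Real.rpow_one]
        _ ≤ (1 - q) ^ (1 - α) :=
            Real.rpow_le_rpow_of_exponent_ge hq (by linarith) (by linarith)
    rw [le_div_iff₀ hpoch]
    calc _ ≤ (1 - q) ^ (α - 1 / 2) * (1 - q) ^ (1 - α) := by gcongr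
      _ = √(1 - q) := by
          rw [← Real.rpow_add hq, Real.sqrt_eq_rpow]
          ring_nf
  have hΓ₁ : 0 < qGamma q (α + 1 / 2) := qGamma_pos hq₀ hq₁ (by linarith)
  have hΓ₂ : 0 < qGamma q (2 * α + 1 / 2) := qGamma_pos hq₀ hq₁ (by linarith)
  rw [show α - 1 / 2 + 1 = α + 1 / 2 by ring, show α + (α - 1 / 2) + 1 = 2 * α + 1 / 2 by ring,
    show α + (α - 1 / 2) = 2 * α - 1 / 2 by ring]
  calc _ ≤ √(1 - q) / qPochInf q (q ^ α) / √(1 - q ^ (1 - 2 * α)) *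
        (qGamma q (α + 1 / 2) / qGamma q (2 * α + 1 / 2) * a ^ (2 * α - 1 / 2)) := by gcongr
    _ = a ^ (2 * α - 1 / 2) * gammaConst q α := by
        rw [gammaConst, Real.sqrt_div hq.le]
        field_simp

end Estimates

section CauchyProblem

variable {E : Type*} [NormedAddCommGroup E] [NormedSpace ℝ E] {q a α : ℝ} {p : ℝ → ℝ}

theorem mem_grid (n : ℕ) : a * q ^ n ∈ grid q a := ⟨n, rfl⟩

theorem mem_gridZero (n : ℕ) : a * q ^ n ∈ gridZero q a := Or.inr (mem_grid n)

theorem infAbs_le (p : ℝ → ℝ) (n : ℕ) : infAbs q a p ≤ |p (a * q ^ n)| :=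
  ciInf_le ⟨0, by rintro _ ⟨x, rfl⟩; exact abs_nonneg _⟩ (⟨_, mem_grid n⟩ : grid q a)

theorem leftInt_zero (ν : ℝ) (f : ℝ → E) : leftInt q ν f 0 = 0 := by
  simp [leftInt, qInt]

theorem leftInt_congr {x ν : ℝ} (hq₀ : 0 < q) (hq₁ : q < 1) (hx : 0 < x) (hν : 0 < ν)
    {f g : ℝ → E} (h : ∀ k : ℕ, f (x * q ^ k) = g (x * q ^ k)) :
    leftInt q ν f x = leftInt q ν g x := by
  simp only [leftInt_eq_tsum_conditional hq₀ hq₁ hx hν, h]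

theorem fracVolterra_congr (hq₀ : 0 < q) (hq₁ : q < 1) (ha : 0 < a) (hα : 0 < α) {f : ℝ → E}
    {g : ℝ → E} (h : ∀ k : ℕ, (p (a * q ^ k))⁻¹ • rightInt q a α f (a * q ^ k) = g (a * q ^ k))
    (n : ℕ) : fracVolterra q a α p f (a * q ^ n) = leftInt q α g (a * q ^ n) :=
  leftInt_congr hq₀ hq₁ (by positivity) hα fun k => by rw [mul_assoc a, ← pow_add, h]

theorem psi_eq_fracVolterra (hq₀ : 0 < q) (hq₁ : q < 1) (ha : 0 < a) (hα : 0 < α) (n : ℕ) :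
    psi q a α p (a * q ^ n) = fracVolterra q a α p (unitMass q a) (a * q ^ n) := by
  refine (fracVolterra_congr hq₀ hq₁ ha hα (fun k => ?_) n).symm
  have hq : 0 < 1 - q := sub_pos.2 hq₁
  have harg : q * (a * q ^ k) / a = q ^ (k + 1) := by
    rw [pow_succ']
    field_simp
  have hpoch := (qPoch_self_pos hq₀ hq₁ hα).ne'
  have hpow := (Real.rpow_pos_of_pos hq α).ne'
  rw [rightInt_unitMass hq₀ hq₁ ha hα, harg, qPoch_pow_succ hq₀ hq₁ hα, qGamma_eq hq₀,
    Real.mul_rpow hq.le ha.le, Real.rpow_sub hq α, Real.rpow_sub hq 1, Real.rpow_one, smul_eq_mul,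
    ← div_div, div_eq_inv_mul _ (p _)]
  congr 1
  field_simp

theorem norm_inv_smul_rightInt_unitMass_le (hq₀ : 0 < q) (hq₁ : q < 1) (ha : 0 < a) (hα₀ : 0 < α)
    (hα₁ : α < 1) (hp : 0 < infAbs q a p) (n : ℕ) :
    ‖(p (a * q ^ n))⁻¹ • rightInt q a α (unitMass q a) (a * q ^ n)‖ ≤
      ((1 - q) * a) ^ (α - 1) / infAbs q a p * (a * q ^ n) ^ (0 : ℝ) := by
  have hqα : q ≤ q ^ α := by
    simpa only [Real.rpow_one] using Real.rpow_le_rpow_of_exponent_ge hq₀ hq₁.le hα₁.le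
  have hqα₁ := Real.rpow_lt_one hq₀.le hq₁ hα₀
  have hmass := Real.rpow_nonneg (mul_pos (sub_pos.2 hq₁) ha).le (α - 1)
  refine norm_inv_smul_le hp (infAbs_le p n) ?_
  rw [rightInt_unitMass hq₀ hq₁ ha hα₀, Real.rpow_zero, mul_one,
    Real.norm_of_nonneg (mul_nonneg (qBinomCoeff_pos hq₀ hq₁ hqα₁ n).le hmass)]
  exact mul_le_of_le_one_left hmass (qBinomCoeff_le_one hq₀ hq₁ hqα hqα₁ n)

theorem exists_norm_psi_le (hq₀ : 0 < q) (hq₁ : q < 1) (ha : 0 < a) (hα₀ : 0 < α) (hα₁ : α < 1)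
    (hp : 0 < infAbs q a p) : ∃ K, ∀ x ∈ gridZero q a, ‖psi q a α p x‖ ≤ K := by
  have hΓ₁ := qGamma_pos hq₀ hq₁ (ν := 0 + 1) (by norm_num)
  have hΓ₂ := qGamma_pos hq₀ hq₁ (ν := α + 0 + 1) (by linarith)
  have := Real.rpow_nonneg (mul_pos (sub_pos.2 hq₁) ha).le (α - 1)
  refine ⟨((1 - q) * a) ^ (α - 1) / infAbs q a p *
    (qGamma q (0 + 1) / qGamma q (α + 0 + 1) * a ^ (α + 0)), ?_⟩
  rintro x (rfl | ⟨n, rfl⟩)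
  · rw [psi, leftInt_zero, norm_zero]
    positivity
  · have hmono : (a * q ^ n) ^ (α + 0) ≤ a ^ (α + 0) :=
      Real.rpow_le_rpow (by positivity)
        (mul_le_of_le_one_right ha.le (pow_le_one₀ hq₀.le hq₁.le)) (by linarith)
    rw [psi_eq_fracVolterra hq₀ hq₁ ha hα₀]
    refine (norm_leftInt_le (μ := 0) hq₀ hq₁ (by positivity) hα₀ (by norm_num) fun k => ?_).trans
      (by gcongr)
    rw [mul_assoc a, ← pow_add]
    exact norm_inv_smul_rightInt_unitMass_le hq₀ hq₁ ha hα₀ hα₁ hp _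

variable [CompleteSpace E]

theorem fracVolterra_unitMass_smul_sub (hq₀ : 0 < q) (hq₁ : q < 1) (ha : 0 < a) (hα₀ : 0 < α)
    (hα₁ : α < 1) (hp : 0 < infAbs q a p) {g : ℝ → E}
    (hg : QIntegrable q a fun t => (p t)⁻¹ • rightInt q a α g t) (e : E) (n : ℕ) :
    fracVolterra q a α p (fun t => unitMass q a t • e - g t) (a * q ^ n) =
      psi q a α p (a * q ^ n) • e - fracVolterra q a α p g (a * q ^ n) := by
  have hx : 0 < a * q ^ n := by positivity
  set φ : ℝ → ℝ := fun t => (p t)⁻¹ • rightInt q a α (unitMass q a) t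
  have hφ : QIntegrable q a φ := .of_norm_le_rpow hq₀ hq₁ ha (by norm_num)
    (norm_inv_smul_rightInt_unitMass_le hq₀ hq₁ ha hα₀ hα₁ hp)
  have hφe : QIntegrable q a fun t => φ t • e := by
    refine (Summable.mul_right ‖e‖ hφ).congr fun k => ?_
    simp only [norm_smul, mul_assoc, φ]
  have hsplit (k : ℕ) : (p (a * q ^ k))⁻¹ •
      rightInt q a α (fun t => unitMass q a t • e - g t) (a * q ^ k) =
      φ (a * q ^ k) • e - (p (a * q ^ k))⁻¹ • rightInt q a α g (a * q ^ k) := by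
    rw [rightInt_sub hq₀ hq₁ ha hα₀, rightInt_smul_const hq₀ hq₁ ha hα₀, smul_sub, smul_assoc]
  rw [fracVolterra_congr (g := fun t => φ t • e - (p t)⁻¹ • rightInt q a α g t) hq₀ hq₁ ha hα₀
      hsplit n,
    leftInt_sub hq₀ hq₁ hx hα₀ (hφe.mul_pow hq₀ n) (hg.mul_pow hq₀ n),
    leftInt_smul_const hq₀ hq₁ hx hα₀ (hφ.mul_pow hq₀ n), psi_eq_fracVolterra hq₀ hq₁ ha hα₀]
  rfl

omit [CompleteSpace E] in
theorem smul_leftCaputo_eq_rightInt (hq₀ : 0 < q) (hq₁ : q < 1) (ha : 0 < a) (hα₀ : 0 < α)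
    (hα₁ : α < 1) {y f : ℝ → E}
    (hquasi : ∀ n : ℕ, quasiDeriv q a α p y (a * q ^ n) = rightInt q a 1 f (a * q ^ n)) (n : ℕ) :
    p (a * q ^ n) • leftCaputo q α y (a * q ^ n) = rightInt q a α f (a * q ^ n) := by
  have hα : 0 < 1 - α := sub_pos.2 hα₁
  refine eq_of_rightInt_eq (f := fun t => p t • leftCaputo q α y t) hq₀ hq₁ ha hα
    (fun n => (hquasi n).trans ?_) n
  rw [rightInt_rightInt_grid hq₀ hq₁ ha hα hα₀, sub_add_cancel]

theorem eq_add_fracVolterra (hq₀ : 0 < q) (hq₁ : q < 1) (ha : 0 < a) (hα₀ : 0 < α) (hα₁ : α < 1)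
    (hp : ∀ n : ℕ, p (a * q ^ n) ≠ 0) {y f : ℝ → E} (hy : IsQRegular q a y)
    (hquasi : ∀ n : ℕ, quasiDeriv q a α p y (a * q ^ n) = rightInt q a 1 f (a * q ^ n)) (n : ℕ) :
    y (a * q ^ n) = y 0 + fracVolterra q a α p f (a * q ^ n) := by
  have hcaputo (k : ℕ) :
      (p (a * q ^ k))⁻¹ • rightInt q a α f (a * q ^ k) = leftCaputo q α y (a * q ^ k) := by
    rw [← smul_leftCaputo_eq_rightInt hq₀ hq₁ ha hα₀ hα₁ hquasi, inv_smul_smul₀ (hp k)]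
  rw [fracVolterra_congr hq₀ hq₁ ha hα₀ hcaputo,
    leftInt_leftCaputo hq₀ hq₁ hα₀ hα₁ (by positivity) (hy _ (mem_gridZero n)), add_sub_cancel]

theorem quasiDeriv_zero_eq_tsum (hq₀ : 0 < q) (hq₁ : q < 1) (ha : 0 < a) (hα₀ : 0 < α)
    (hα₁ : α < 1) {y f : ℝ → E}
    (hquasi : ∀ n : ℕ, quasiDeriv q a α p y (a * q ^ n) = rightInt q a 1 f (a * q ^ n))
    (hf : Summable fun k => ‖gridMass q a k • f (a * q ^ k)‖) :
    quasiDeriv q a α p y 0 = ∑' k, gridMass q a k • f (a * q ^ k) := by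
  have hα : 0 < 1 - α := sub_pos.2 hα₁
  rw [quasiDeriv, rightInt_congr_zero hq₀ hq₁ ha (1 - α)
      (smul_leftCaputo_eq_rightInt hq₀ hq₁ ha hα₀ hα₁ hquasi),
    rightInt_rightInt_zero hq₀ hq₁ ha hα hα₀ (by simpa only [sub_add_cancel, Real.rpow_one]),
    sub_add_cancel, rightInt_one_zero hq₀ hq₁ ha hf.of_norm]

omit [CompleteSpace E] in
theorem eq_rightInt_one_of_qDeriv_inv (hq₀ : 0 < q) (hq₁ : q < 1) (ha : 0 < a) {u g : ℝ → E}
    (h : ∀ k : ℕ, (-1 / q) • qDeriv q⁻¹ u (a * q ^ k) + g (a * q ^ k) = 0) (n : ℕ) :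
    u (a * q ^ n) = rightInt q a 1 (fun t => unitMass q a t • u (a / q) - g t) (a * q ^ n) := by
  have hstep (k : ℕ) :
      u (a * q ^ k) = u (q⁻¹ * (a * q ^ k)) - gridMass q a k • g (a * q ^ k) := by
    have hmass := (gridMass_pos hq₀ hq₁ ha k).ne'
    have hcoef : -1 / q * (a * q ^ k - q⁻¹ * (a * q ^ k))⁻¹ = (gridMass q a k)⁻¹ := by
      rw [← inv_inv (-1 / q), ← mul_inv, gridMass]
      congr 1
      field_simp
      ring
    rw [← neg_eq_of_add_eq_zero_right (h k), qDeriv, smul_smul, hcoef,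
      smul_neg, smul_inv_smul₀ hmass, sub_neg_eq_add, add_sub_cancel]
  rw [rightInt_one_grid hq₀ hq₁ ha]
  simp only [smul_sub, smul_smul, gridMass_mul_unitMass hq₀ hq₁ ha, ite_smul, one_smul, zero_smul]
  induction n with
  | zero =>
    rw [hstep 0]
    simp [div_eq_inv_mul]
  | succ n ih =>
    have hprev : q⁻¹ * (a * q ^ (n + 1)) = a * q ^ n := by
      rw [pow_succ]
      field_simp
    rw [Finset.sum_range_succ, ← ih, hstep (n + 1), hprev, if_neg n.succ_ne_zero, zero_sub,
      sub_eq_add_neg]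

omit [CompleteSpace E] in
theorem hasSum_gridMass_smul_unitMass_smul_sub (hq₀ : 0 < q) (hq₁ : q < 1) (ha : 0 < a)
    {g : ℝ → E} (hg : Summable fun k => gridMass q a k • g (a * q ^ k)) (e : E) :
    HasSum (fun k => gridMass q a k • (unitMass q a (a * q ^ k) • e - g (a * q ^ k)))
      (e - ∑' k, gridMass q a k • g (a * q ^ k)) := by
  simp only [smul_sub, smul_smul, gridMass_mul_unitMass hq₀ hq₁ ha, ite_smul, one_smul, zero_smul]
  exact (hasSum_ite_eq 0 e).sub hg.hasSum

end CauchyProblem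

section BoundaryValue

variable {E : Type*} [NormedAddCommGroup E] {q a α κ : ℝ} {p r w : ℝ → ℝ} {c₁ c₂ d₁ d₂ : ℝ}

theorem infAbs_pos (hp : 0 < ⨅ x : grid q a, p x) : 0 < infAbs q a p := by
  have hbdd : BddBelow (range fun x : grid q a => p x) := by
    by_contra h
    rw [Real.iInf_of_not_bddBelow h] at hp
    exact lt_irrefl _ hp
  have : Nonempty (grid q a) := ⟨⟨_, mem_grid 0⟩⟩
  exact hp.trans_le (le_ciInf fun x => (ciInf_le hbdd x).trans (le_abs_self _))

theorem norm_le_supNorm {f : ℝ → E} {K : ℝ} (hf : ∀ x ∈ gridZero q a, ‖f x‖ ≤ K) {x : ℝ}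
    (hx : x ∈ gridZero q a) : ‖f x‖ ≤ supNorm q a f :=
  le_ciSup (f := fun x : gridZero q a => ‖f x‖)
    ⟨K, by rintro _ ⟨x, rfl⟩; exact hf x x.2⟩ ⟨x, hx⟩

theorem norm_coefA_le_supNorm (hq₀ : 0 < q) (hq₁ : q < 1) (ha : 0 < a) (hα₀ : 0 < α) (hα₁ : α < 1)
    (hp : 0 < infAbs q a p) (n : ℕ) :
    ‖coefA q a α p c₁ c₂ d₁ d₂ (a * q ^ n)‖ ≤ supNorm q a (coefA q a α p c₁ c₂ d₁ d₂) := by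
  obtain ⟨K, hK⟩ := exists_norm_psi_le hq₀ hq₁ ha hα₀ hα₁ hp
  have haK : ‖psi q a α p a‖ ≤ K := by simpa using hK _ (mem_gridZero 0)
  refine norm_le_supNorm (K := ‖c₂ / Delta q a α p c₁ c₂ d₁ d₂‖ * (‖d₂‖ + ‖d₁‖ * (K + K)))
    (fun x hx => ?_) (mem_gridZero n)
  rw [coefA, norm_mul]
  gcongr
  refine norm_add_le_of_le le_rfl ?_
  rw [norm_mul]
  gcongr
  exact norm_sub_le_of_le haK (hK x hx)

theorem norm_coefB_le_supNorm (hq₀ : 0 < q) (hq₁ : q < 1) (ha : 0 < a) (hα₀ : 0 < α) (hα₁ : α < 1)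
    (hp : 0 < infAbs q a p) (n : ℕ) :
    ‖coefB q a α p c₁ c₂ d₁ d₂ (a * q ^ n)‖ ≤ supNorm q a (coefB q a α p c₁ c₂ d₁ d₂) := by
  obtain ⟨K, hK⟩ := exists_norm_psi_le hq₀ hq₁ ha hα₀ hα₁ hp
  refine norm_le_supNorm (K := ‖d₁ / Delta q a α p c₁ c₂ d₁ d₂‖ * (‖c₁‖ * K + ‖c₂‖))
    (fun x hx => ?_) (mem_gridZero n)
  rw [coefB, norm_mul]
  gcongr
  refine norm_sub_le_of_le ?_ le_rfl
  rw [norm_mul]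
  gcongr
  exact hK x hx

/-- The Green operator of the boundary value problem: `greenOp q a α p c₁ c₂ d₁ d₂ g` is the
solution `y` of `D^α_{q,a-} (p ᶜD^α_{q,0+} y) + g = 0` with the two boundary conditions. -/
def greenOp [NormedSpace ℝ E] (q a α : ℝ) (p : ℝ → ℝ) (c₁ c₂ d₁ d₂ : ℝ) (g : ℝ → E) (x : ℝ) : E :=
  coefA q a α p c₁ c₂ d₁ d₂ x • ∑' k, gridMass q a k • g (a * q ^ k) +
    coefB q a α p c₁ c₂ d₁ d₂ x • fracVolterra q a α p g a - fracVolterra q a α p g x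

theorem norm_greenOp_le [NormedSpace ℝ E] [CompleteSpace E] (hq₀ : 0 < q) (hq₁ : q < 1)
    (ha : 0 < a) (hα₀ : 0 < α) (hα₁ : α < 1) (hp : 0 < infAbs q a p)
    (hκ : IsVolterraConst E q a α κ) {g : ℝ → E} (hg : MemL2 q a g) (n : ℕ) :
    ‖greenOp q a α p c₁ c₂ d₁ d₂ g (a * q ^ n)‖ ≤
      (bound q a α p c₁ c₂ d₁ d₂ κ)⁻¹ * normL2 q a g := by
  have hV := hκ.norm_le hp (infAbs_le p) hg
  have hVa := hV 0
  rw [pow_zero, mul_one] at hVa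
  have hA := norm_coefA_le_supNorm (c₁ := c₁) (c₂ := c₂) (d₁ := d₁) (d₂ := d₂)
    hq₀ hq₁ ha hα₀ hα₁ hp n
  have hB := norm_coefB_le_supNorm (c₁ := c₁) (c₂ := c₂) (d₁ := d₁) (d₂ := d₂)
    hq₀ hq₁ ha hα₀ hα₁ hp n
  rw [bound, inv_div]
  set A := supNorm q a (coefA q a α p c₁ c₂ d₁ d₂)
  set B := supNorm q a (coefB q a α p c₁ c₂ d₁ d₂)
  calc ‖greenOp q a α p c₁ c₂ d₁ d₂ g (a * q ^ n)‖
      ≤ A * (√a * normL2 q a g) +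
          B * (a ^ (2 * α - 1 / 2) * κ / infAbs q a p * normL2 q a g) +
          a ^ (2 * α - 1 / 2) * κ / infAbs q a p * normL2 q a g := by
        refine norm_sub_le_of_le (norm_add_le_of_le ?_ ?_) (hV n) <;> rw [norm_smul]
        · exact mul_le_mul hA (norm_tsum_gridMass_smul_le hq₀ hq₁ ha hg) (norm_nonneg _)
            ((norm_nonneg _).trans hA)
        · exact mul_le_mul hB hVa (norm_nonneg _) ((norm_nonneg _).trans hB)
    _ = ((1 + B) * a ^ (2 * α - 1 / 2) * κ + A * √a * infAbs q a p) / infAbs q a p *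
          normL2 q a g := by
        field_simp
        ring

variable {𝕜 : Type*} [RCLike 𝕜] {lam : 𝕜} {y u : ℝ → 𝕜}

/-- The coefficient `r - λ w` of `y` in the equation. -/
def potential (r w : ℝ → ℝ) (lam : 𝕜) (x : ℝ) : 𝕜 := r x - lam * w x

theorem memL2_potential (hq₀ : 0 < q) (hr : MemL2 q a r) (hw : MemL2 q a w) (lam : 𝕜) :
    MemL2 q a (potential r w lam) := by
  refine memL2_sub hq₀ (hr.of_norm_le (g := fun x => (r x : 𝕜)) (M := 1) hq₀ fun k => ?_)
    (hw.of_norm_le (g := fun x => lam * (w x : 𝕜)) (M := ‖lam‖) hq₀ fun k => ?_)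
  · rw [RCLike.norm_ofReal, mul_one, Real.norm_eq_abs]
  · rw [norm_mul, RCLike.norm_ofReal, mul_comm, Real.norm_eq_abs]

theorem IsExtSolution.eq_rightInt_one (hq₀ : 0 < q) (hq₁ : q < 1) (ha : 0 < a)
    (h : IsExtSolution q a α p r w c₁ c₂ d₁ d₂ lam y u) (n : ℕ) :
    u (a * q ^ n) = rightInt q a 1
      (fun t => unitMass q a t • u (a / q) - potential r w lam t * y t) (a * q ^ n) := by
  refine eq_rightInt_one_of_qDeriv_inv hq₀ hq₁ ha (fun k => ?_) n
  rw [← h.equation _ (mem_grid k), potential, RCLike.real_smul_eq_coe_mul (r _),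
    RCLike.real_smul_eq_coe_mul (w _)]
  ring

theorem eq_coefA_smul_add_coefB_smul_sub (hΔ : Delta q a α p c₁ c₂ d₁ d₂ ≠ 0) {y₀ U G V : 𝕜}
    (hbc₀ : c₁ • y₀ + c₂ • (U - G) = 0)
    (hbc₁ : d₁ • (y₀ + (psi q a α p a • U - V)) + d₂ • U = 0) (x : ℝ) (v : 𝕜) :
    y₀ + (psi q a α p x • U - v) =
      coefA q a α p c₁ c₂ d₁ d₂ x • G + coefB q a α p c₁ c₂ d₁ d₂ x • V - v := by
  have hΔ' : ((Delta q a α p c₁ c₂ d₁ d₂ : ℝ) : 𝕜) ≠ 0 := RCLike.ofReal_ne_zero.2 hΔ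
  have hA : ((Delta q a α p c₁ c₂ d₁ d₂ : ℝ) : 𝕜) * ((coefA q a α p c₁ c₂ d₁ d₂ x : ℝ) : 𝕜) =
      (c₂ * (d₂ + d₁ * (psi q a α p a - psi q a α p x)) : ℝ) := by
    rw [← RCLike.ofReal_mul, coefA, ← mul_assoc, mul_div_cancel₀ _ hΔ]
  have hB : ((Delta q a α p c₁ c₂ d₁ d₂ : ℝ) : 𝕜) * ((coefB q a α p c₁ c₂ d₁ d₂ x : ℝ) : 𝕜) =
      (d₁ * (c₁ * psi q a α p x - c₂) : ℝ) := by
    rw [← RCLike.ofReal_mul, coefB, ← mul_assoc, mul_div_cancel₀ _ hΔ]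
  have hD : ((Delta q a α p c₁ c₂ d₁ d₂ : ℝ) : 𝕜) =
      (c₁ * d₂ - c₂ * d₁ + c₁ * d₁ * psi q a α p a : ℝ) := rfl
  refine mul_left_cancel₀ hΔ' ?_
  simp only [RCLike.real_smul_eq_coe_mul] at hbc₀ hbc₁ ⊢
  push_cast at hA hB hD
  linear_combination (d₂ + d₁ * (psi q a α p a : 𝕜)) * hbc₀ - c₂ * hbc₁ +
    (psi q a α p x : 𝕜) * (c₁ * hbc₁ - d₁ * hbc₀) - G * hA - V * hB +
    (y₀ + (psi q a α p x : 𝕜) * U) * hD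

theorem IsExtSolution.eq_greenOp (hq₀ : 0 < q) (hq₁ : q < 1) (ha : 0 < a) (hα₀ : 0 < α)
    (hα₁ : α < 1) (hp : 0 < infAbs q a p) (hκ : IsVolterraConst 𝕜 q a α κ)
    (hΔ : Delta q a α p c₁ c₂ d₁ d₂ ≠ 0)
    (h : IsExtSolution q a α p r w c₁ c₂ d₁ d₂ lam y u)
    (hg : MemL2 q a fun t => potential r w lam t * y t) (n : ℕ) :
    y (a * q ^ n) =
      greenOp q a α p c₁ c₂ d₁ d₂ (fun t => potential r w lam t * y t) (a * q ^ n) := by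
  set g := fun t => potential r w lam t * y t
  have hquasi (n : ℕ) := (h.quasi _ (mem_gridZero n)).symm.trans (h.eq_rightInt_one hq₀ hq₁ ha n)
  have hsum := hasSum_gridMass_smul_unitMass_smul_sub hq₀ hq₁ ha
    (summable_norm_gridMass_smul hq₀ hq₁ ha hg).of_norm (u (a / q))
  have hu₀ : u 0 = u (a / q) - ∑' k, gridMass q a k • g (a * q ^ k) := by
    rw [h.quasi 0 (Or.inl rfl), quasiDeriv_zero_eq_tsum hq₀ hq₁ ha hα₀ hα₁ hquasi
      hsum.summable.norm, hsum.tsum_eq]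
  have hy (n : ℕ) : y (a * q ^ n) =
      y 0 + (psi q a α p (a * q ^ n) • u (a / q) - fracVolterra q a α p g (a * q ^ n)) := by
    rw [eq_add_fracVolterra hq₀ hq₁ ha hα₀ hα₁
        (fun n => abs_pos.1 (hp.trans_le (infAbs_le p n))) h.regular hquasi,
      fracVolterra_unitMass_smul_sub hq₀ hq₁ ha hα₀ hα₁ hp (hκ.integrable hp (infAbs_le p) hg)]
  have hya := hy 0
  rw [pow_zero, mul_one] at hya
  rw [hy n, greenOp, eq_coefA_smul_add_coefB_smul_sub hΔ (hu₀ ▸ h.bc_zero) (hya ▸ h.bc_right)]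

theorem IsExtSolution.eqOn_zero (hq₀ : 0 < q) (hq₁ : q < 1) (ha : 0 < a) (hα₀ : 0 < α)
    (hα₁ : α < 1) (hp : 0 < infAbs q a p) (hκ : IsVolterraConst 𝕜 q a α κ)
    (hΔ : Delta q a α p c₁ c₂ d₁ d₂ ≠ 0) (hrw : MemL2 q a (potential r w lam))
    (hlam : normL2 q a (potential r w lam) < bound q a α p c₁ c₂ d₁ d₂ κ)
    (h : IsExtSolution q a α p r w c₁ c₂ d₁ d₂ lam y u) : EqOn y (fun _ => 0) (gridZero q a) := by
  have hlim : Tendsto (fun n : ℕ => y (a * q ^ n)) atTop (𝓝 (y 0)) := by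
    simpa using h.regular _ (mem_gridZero 0)
  set M := ⨆ n : ℕ, ‖y (a * q ^ n)‖
  have hyM (n : ℕ) : ‖y (a * q ^ n)‖ ≤ M := le_ciSup hlim.norm.bddAbove_range n
  have hM : 0 ≤ M := (norm_nonneg _).trans (hyM 0)
  have hprod (k : ℕ) : ‖potential r w lam (a * q ^ k) * y (a * q ^ k)‖ ≤
      ‖potential r w lam (a * q ^ k)‖ * M := norm_mul_le_of_le le_rfl (hyM k)
  have hg := hrw.of_norm_le (g := fun t => potential r w lam t * y t) hq₀ hprod
  have hbound := (normL2_nonneg _).trans_lt hlam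
  set θ := (bound q a α p c₁ c₂ d₁ d₂ κ)⁻¹ * normL2 q a (potential r w lam)
  have hθ : θ < 1 := (inv_mul_lt_one₀ hbound).2 hlam
  have hcontr : M ≤ θ * M := ciSup_le fun n => by
    rw [h.eq_greenOp hq₀ hq₁ ha hα₀ hα₁ hp hκ hΔ hg n, mul_assoc]
    exact (norm_greenOp_le hq₀ hq₁ ha hα₀ hα₁ hp hκ hg n).trans
      (mul_le_mul_of_nonneg_left (normL2_le_mul hq₀ hq₁ ha hrw hM hprod) (inv_pos.2 hbound).le)
  have hM₀ : M = 0 := by nlinarith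
  have hy (n : ℕ) : y (a * q ^ n) = 0 := norm_le_zero_iff.1 ((hyM n).trans_eq hM₀)
  rintro x (rfl | ⟨n, rfl⟩)
  · simp only [hy] at hlim
    exact (tendsto_nhds_unique tendsto_const_nhds hlim).symm
  · exact hy n

theorem leftInt_fun_zero [NormedSpace ℝ E] (ν : ℝ) :
    leftInt q ν (fun _ => (0 : E)) = fun _ => 0 := by
  funext x
  simp [leftInt, qInt, qIntZero]

theorem rightInt_fun_zero [NormedSpace ℝ E] (ν : ℝ) :
    rightInt q a ν (fun _ => (0 : E)) = fun _ => 0 := by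
  funext x
  simp [rightInt, qInt, qIntZero]

theorem isSolution_zero : IsSolution q a α p r w c₁ c₂ d₁ d₂ lam (fun _ => (0 : 𝕜)) := by
  have hqDeriv (b : ℝ) : qDeriv b (fun _ => (0 : 𝕜)) = fun _ => 0 := by
    funext x
    simp [qDeriv]
  have hcaputo : leftCaputo q α (fun _ => (0 : 𝕜)) = fun _ => 0 := by
    rw [leftCaputo, hqDeriv, leftInt_fun_zero]
  have hquasi : quasiDeriv q a α p (fun _ => (0 : 𝕜)) = fun _ => 0 := by
    simp only [quasiDeriv, hcaputo, smul_zero, rightInt_fun_zero]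
  refine ⟨fun _ _ => tendsto_const_nhds, fun x _ => ?_, ⟨0, ?_, ?_⟩, ?_, ?_⟩
  · simp [rightDeriv, hcaputo, rightInt_fun_zero, hqDeriv]
  all_goals simp [hquasi]

end BoundaryValue

end QFSL

end

theorem theorem3p8_general {𝕜 : Type*} [RCLike 𝕜]
    {q a α : ℝ} (hq₀ : 0 < q) (hq₁ : q < 1) (ha : 0 < a) {p r w : ℝ → ℝ}
    (hp : 0 < QFSL.infAbs q a p) {c₁ c₂ d₁ d₂ : ℝ} (hΔ : QFSL.Delta q a α p c₁ c₂ d₁ d₂ ≠ 0)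
    {lam : 𝕜} (hrw : QFSL.MemL2 q a (fun x => (r x : 𝕜) - lam * (w x : 𝕜)))
    (hlam :
      (1 / 2 < α ∧ α < 1 ∧
        QFSL.normL2 q a (fun x => (r x : 𝕜) - lam * (w x : 𝕜)) <
          QFSL.bound q a α p c₁ c₂ d₁ d₂ (QFSL.cConst q α)) ∨
      (1 / 4 ≤ α ∧ α < 1 / 2 ∧
        QFSL.normL2 q a (fun x => (r x : 𝕜) - lam * (w x : 𝕜)) <
          QFSL.bound q a α p c₁ c₂ d₁ d₂ (QFSL.gammaConst q α))) :
    (∃ y : ℝ → 𝕜,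
      QFSL.IsSolution q a α p r w c₁ c₂ d₁ d₂ lam y ∧
      ∀ z v : ℝ → 𝕜, QFSL.IsExtSolution q a α p r w c₁ c₂ d₁ d₂ lam z v →
        Set.EqOn z y (QFSL.gridZero q a)) ∧
    ¬ QFSL.IsEigenvalue q a α p r w c₁ c₂ d₁ d₂ lam := by
  have hzero (z v : ℝ → 𝕜) (h : QFSL.IsExtSolution q a α p r w c₁ c₂ d₁ d₂ lam z v) :
      Set.EqOn z (fun _ => 0) (QFSL.gridZero q a) := by
    rcases hlam with ⟨hα, hα₁, hlt⟩ | ⟨hα, hα₁, hlt⟩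
    · exact h.eqOn_zero hq₀ hq₁ ha (by linarith) hα₁ hp
        (QFSL.isVolterraConst_cConst hq₀ hq₁ ha hα hα₁) hΔ hrw hlt
    · exact h.eqOn_zero hq₀ hq₁ ha (by linarith) (by linarith) hp
        (QFSL.isVolterraConst_gammaConst hq₀ hq₁ ha hα hα₁) hΔ hrw hlt
  exact ⟨⟨_, QFSL.isSolution_zero, hzero⟩,
    fun ⟨y, u, hyu, x, hx, hne⟩ => hne (hzero y u hyu hx)⟩

theorem theorem3p8 {𝕜 : Type*} [RCLike 𝕜]
    (q a α : ℝ) (hq₀ : 0 < q) (hq₁ : q < 1) (ha : 0 < a)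
    (p r w : ℝ → ℝ)
    (hp₀ : ∀ x ∈ QFSL.gridZero q a, p x ≠ 0)
    (hp : 0 < ⨅ x : QFSL.grid q a, p x)
    (hw₀ : ∀ x ∈ QFSL.gridZero q a, 0 < w x)
    (hr : QFSL.MemL2 q a r) (hw : QFSL.MemL2 q a w)
    (c₁ c₂ d₁ d₂ : ℝ) (hc : c₁ ^ 2 + c₂ ^ 2 ≠ 0) (hd : d₁ ^ 2 + d₂ ^ 2 ≠ 0)
    (hΔ : QFSL.Delta q a α p c₁ c₂ d₁ d₂ ≠ 0)
    (lam : 𝕜)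
    (hlam :
      (1 / 2 < α ∧ α < 1 ∧
        QFSL.normL2 q a (fun x => (r x : 𝕜) - lam * (w x : 𝕜)) <
          QFSL.bound q a α p c₁ c₂ d₁ d₂ (QFSL.cConst q α)) ∨
      (1 / 4 < α ∧ α < 1 / 2 ∧
        QFSL.normL2 q a (fun x => (r x : 𝕜) - lam * (w x : 𝕜)) <
          QFSL.bound q a α p c₁ c₂ d₁ d₂ (QFSL.gammaConst q α))) :
    (∃ y : ℝ → 𝕜,
      QFSL.IsSolution q a α p r w c₁ c₂ d₁ d₂ lam y ∧
      ∀ z v : ℝ → 𝕜, QFSL.IsExtSolution q a α p r w c₁ c₂ d₁ d₂ lam z v →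
        Set.EqOn z y (QFSL.gridZero q a)) ∧
    (QFSL.IsEigenvalue q a α p r w c₁ c₂ d₁ d₂ lam →
      QFSL.IsSimpleEigenvalue q a α p r w c₁ c₂ d₁ d₂ lam) := by
  obtain ⟨hunique, hnot⟩ := theorem3p8_general hq₀ hq₁ ha (QFSL.infAbs_pos hp) hΔ
    (QFSL.memL2_potential hq₀ hr hw lam) (hlam.imp_right fun h => ⟨h.1.le, h.2⟩)
  exact ⟨hunique, fun h => (hnot h).elim⟩
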